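/- **Definitions.** A *precubical set* is a graded set $P=(P_n)_{n\ge 0}$ with maps $d^k_i\colon P_n\to P_{n-1}$ ($n>0$, $k\in\{0,1\}$, $1\le i\le n$) such that $d^k_i d^l_j=d^l_{j-1}d^k_i$ for $i<j$; morphisms are the degree-preserving maps commuting with the $d^k_i$. It is *$n$-truncated* if $P_m=\emptyset$ for $m>n$; its *$n$-skeleton* $P_{\le n}$ consists of the cubes of degree $\le n$. The *tensor product* is given by $(P\otimes Q)_n=\coprod_{p+q=n}P_p\times Q_q$, with $d^k_i(x,y)=(d^k_ix,y)$ for $i\le p$ and $d^k_i(x,y)=(x,d^k_{i-p}y)$ for $i>p$. A *higher-dimensional automaton* (HDA) $\mathcal A=(P,I,F,\Sigma,\lambda)$ consists of a precubical set $P$, a vertex $I\in P_0$, a set $F\subseteq P_0$, a set $\Sigma$ of labels, and a map $\lambda\colon P_1\to\Sigma$ with $\lambda(d^0_ix)=\lambda(d^1_ix)$ for all $x\in P_2$, $i\in\{1,2\}$. A morphism is a pair $(f,\sigma)$ of a morphism of precubical sets $f$ and a map of label sets $\sigma$ such that $f(I)=I$, $f(F)\subseteq F$ and $\lambda(f(x))=\sigma(\lambda(x))$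 for all edges $x$. Truncation and skeleta of HDAs are those of the underlying precubical sets. An HDA is *extensional* if two edges with the same label, the same initial vertex $d^0_1$ and the same final vertex $d^1_1$ are equal; $\mathsf{HDA_{ext}}$ (resp. $\mathsf{HDA_{ext}}_2$) is the full subcategory of extensional (resp. 2-truncated extensional) HDAs. The tensor product $\mathcal A\otimes\mathcal B$ has underlying precubical set $P_{\mathcal A}\otimes P_{\mathcal B}$, initial state $(I_{\mathcal A},I_{\mathcal B})$, final states $F_{\mathcal A}\times F_{\mathcal B}$, labels $\Sigma_{\mathcal A}\amalg\Sigma_{\mathcal B}$, and $\lambda(x,y)=\lambda_{\mathcal A}(x)$ if $\deg x=1$, $\lambda(x,y)=\lambda_{\mathcal B}(y)$ if $\deg y=1$. With it, and with the unit having one vertex (initial and final), no other cubes and no labels, and the evident associativity and unit isomorphisms, $\mathsf{HDA_{ext}}$ is a monoidal category. A *$\ltimes$-transition system* $\mathcal T$ is a 1-truncated extensional HDA $U(\mathcal T)$ (the underlying transition system) with a relation $\ltimes_{\mathcal T}$ on its set of labels; a morphism is a morphism of HDAs $(f,\sigma)$ between the underlying transition systems such that $\alpha\ltimes\beta$ implies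 $\sigma(\alpha)\ltimes\sigma(\beta)$. The *interleaving* $\mathcal S\mathbin{|||}\mathcal T$ is given by $U(\mathcal S\mathbin{|||}\mathcal T)=(U(\mathcal S)\otimes U(\mathcal T))_{\le 1}$, where $\alpha\ltimes\beta$ holds iff $\alpha,\beta\in\Sigma_{\mathcal S}$ and $\alpha\ltimes_{\mathcal S}\beta$, or $\alpha,\beta\in\Sigma_{\mathcal T}$ and $\alpha\ltimes_{\mathcal T}\beta$, or $\alpha\in\Sigma_{\mathcal S}$ and $\beta\in\Sigma_{\mathcal T}$. With $\mathbin{|||}$, the category $\mathsf{TS}_\ltimes$ of $\ltimes$-transition systems is monoidal, with the corresponding unit, associativity and unit isomorphisms. An *independence square* in $\mathcal T$ is a family of edges $(x^k_i)_{k\in\{0,1\},i\in\{1,2\}}$ with $d^k_1x^l_2=d^l_1x^k_1$ for all $k,l$ and $\lambda(x^0_2)=\lambda(x^1_2)\ltimes_{\mathcal T}\lambda(x^0_1)=\lambda(x^1_1)$. The functor $\varPsi\colon\mathsf{TS}_\ltimes\to\mathsf{HDA_{ext}}_2$ adds to $U(\mathcal T)$ the independence squares as 2-cubes, with $d^l_j((x^k_i)_{k,i})=x^l_j$.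 The functor $\varGamma_2\colon\mathsf{HDA_{ext}}_2\to\mathsf{HDA_{ext}}$ is the 2-coskeleton: the $m$-cubes of $\varGamma_2P$ are the morphisms $(\llbracket 0,1\rrbracket^{\otimes m})_{\le 2}\to P$, where $\llbracket 0,1\rrbracket$ is the precubical set with two vertices $0,1$ and one edge from $0$ to $1$; initial state, final states and labels are those of the given HDA under $(\varGamma_2P)_{\le 1}=P_{\le 1}$. The *HDA model functor* is $\mathscr A=\varGamma_2\circ\varPsi\colon\mathsf{TS}_\ltimes\to\mathsf{HDA_{ext}}$; one has $\mathscr A(\mathcal T)_{\le 1}=U(\mathcal T)$, and hence $(\mathscr A(\mathcal S)\otimes\mathscr A(\mathcal T))_{\le 1}=U(\mathcal S\mathbin{|||}\mathcal T)$. **Theorem.** The functor $\mathscr A\colon(\mathsf{TS}_\ltimes,\mathbin{|||})\to(\mathsf{HDA_{ext}},\otimes)$ is strong monoidal. More precisely, it has a strong monoidal structure whose natural isomorphisms $$\mu_{\mathcal S,\mathcal T}\colon\mathscr A(\mathcal S)\otimes\mathscr A(\mathcal T)\xrightarrow{\ \cong\ }\mathscr A(\mathcal S\mathbin{|||}\mathcal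 T)$$ restrict to the identity of $U(\mathcal S\mathbin{|||}\mathcal T)$ on 1-skeleta, and $\mu_{\mathcal S,\mathcal T}$ is the only morphism $\mathscr A(\mathcal S)\otimes\mathscr A(\mathcal T)\to\mathscr A(\mathcal S\mathbin{|||}\mathcal T)$ with this property. -/

import Mathlib

open CategoryTheory MonoidalCategory

universe u v

/-! ### Precubical sets

Face operators are indexed by `k : Fin 2` (the two ends) and `i : Fin n`, so that `d _ k i` is the
operator usually written `d^k_{i+1}`. The hypothesis `m + 1 = n` is only a flexible way of writing
`d : cube (m + 1) → cube m`. -/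

/-- A precubical set: a graded set with face operators satisfying
`d^k_i ∘ d^l_j = d^l_{j-1} ∘ d^k_i` for `i < j`. -/
structure PrecubicalSet where
  /-- the `n`-cubes -/
  cube : ℕ → Type u
  /-- the face operators -/
  d : ∀ {m n : ℕ}, m + 1 = n → Fin 2 → Fin n → cube n → cube m
  d_d : ∀ {m n r : ℕ} (h : m + 1 = n) (h' : n + 1 = r) (k l : Fin 2) (i j : ℕ) (hij : i < j)
    (hj : j < r) (x : cube r),
    d h k ⟨i, by omega⟩ (d h' l ⟨j, hj⟩ x) = d h l ⟨j - 1, by omega⟩ (d h' k ⟨i, by omega⟩ x)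

namespace PrecubicalSet

/-- Morphisms of precubical sets. -/
@[ext]
structure Hom (P Q : PrecubicalSet.{u}) where
  /-- the map in degree `n` -/
  app : ∀ n : ℕ, P.cube n → Q.cube n
  map_d : ∀ {m n : ℕ} (h : m + 1 = n) (k : Fin 2) (i : Fin n) (x : P.cube n),
    app m (P.d h k i x) = Q.d h k i (app n x)

/-- The identity morphism. -/
def Hom.id (P : PrecubicalSet.{u}) : Hom P P where
  app _ x := x
  map_d _ _ _ _ := rfl

/-- Composition, in diagrammatic order. -/
def Hom.comp {P Q R : PrecubicalSet.{u}} (f : Hom P Q) (g : Hom Q R) : Hom P R where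
  app n x := g.app n (f.app n x)
  map_d h k i x := by rw [f.map_d, g.map_d]

/-- `P` is `n`-truncated if it has no cubes of degree `> n`. -/
def IsTruncated (n : ℕ) (P : PrecubicalSet.{u}) : Prop :=
  ∀ m : ℕ, n < m → IsEmpty (P.cube m)

/-- The `n`-skeleton of `P`: the cubes of degree `≤ n`. -/
def skeleton (n : ℕ) (P : PrecubicalSet.{u}) : PrecubicalSet.{u} where
  cube m := { _x : P.cube m // m ≤ n }
  d h k i x := ⟨P.d h k i x.1, by have := x.2; omega⟩
  d_d h h' k l i j hij hj x := Subtype.ext (P.d_d h h' k l i j hij hj x.1)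

theorem skeleton_mk_heq {n m l : ℕ} {P : PrecubicalSet.{u}} {x : P.cube m} {y : P.cube l}
    (h : m = l) (hm : m ≤ n) (hl : l ≤ n) (hxy : x ≍ y) :
    (⟨x, hm⟩ : (P.skeleton n).cube m) ≍ (⟨y, hl⟩ : (P.skeleton n).cube l) := by
  subst h
  rw [eq_of_heq hxy]

/-- The morphism induced on `n`-skeleta. -/
def Hom.skeleton (n : ℕ) {P Q : PrecubicalSet.{u}} (f : Hom P Q) :
    Hom (P.skeleton n) (Q.skeleton n) where
  app m x := ⟨f.app m x.1, x.2⟩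
  map_d h k i x := Subtype.ext (f.map_d h k i x.1)

/-- The inclusion of the `n`-skeleton. -/
def skeletonIncl (n : ℕ) (P : PrecubicalSet.{u}) : Hom (P.skeleton n) P where
  app _ x := x.1
  map_d _ _ _ _ := rfl

/-! ### Tensor product of precubical sets -/

/-- The `n`-cubes of `P ⊗ Q`: pairs `(x, y) ∈ P_p × Q_q` with `p + q = n`. -/
@[ext]
structure TensorCube (P Q : PrecubicalSet.{u}) (n : ℕ) where
  /-- the degree of the first component -/
  p : ℕ
  /-- the degree of the second component -/
  q : ℕ
  deg : p + q = n
  /-- the first component -/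
  fst : P.cube p
  /-- the second component -/
  snd : Q.cube q

/-- `d^k_i (x, y) = (d^k_i x, y)` for the first `p` values of `i`, and `(x, d^k_{i-p} y)` for the
others. -/
def TensorCube.d {P Q : PrecubicalSet.{u}} {m n : ℕ} (h : m + 1 = n) (k : Fin 2) (i : Fin n)
    (c : TensorCube P Q n) : TensorCube P Q m :=
  if hi : (i : ℕ) < c.p then
    ⟨c.p - 1, c.q, by have := c.deg; omega, P.d (by omega) k ⟨i, hi⟩ c.fst, c.snd⟩
  else
    ⟨c.p, c.q - 1, by have := c.deg; omega, c.fst,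
      Q.d (by have := c.deg; omega) k ⟨i - c.p, by have := c.deg; omega⟩ c.snd⟩

theorem TensorCube.d_left {P Q : PrecubicalSet.{u}} {m n p q p' : ℕ} (h : m + 1 = n) (k : Fin 2)
    (i : ℕ) (hi : i < n) (e : p + q = n) (x : P.cube p) (y : Q.cube q) (hp : p' + 1 = p)
    (hip : i < p) :
    TensorCube.d h k ⟨i, hi⟩ ⟨p, q, e, x, y⟩ = ⟨p', q, by omega, P.d hp k ⟨i, hip⟩ x, y⟩ := by
  subst hp
  exact dif_pos hip

theorem TensorCube.d_right {P Q : PrecubicalSet.{u}} {m n p q q' : ℕ} (h : m + 1 = n) (k : Fin 2)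
    (i : ℕ) (hi : i < n) (e : p + q = n) (x : P.cube p) (y : Q.cube q) (hq : q' + 1 = q)
    (j : ℕ) (hj : j + p = i) :
    TensorCube.d h k ⟨i, hi⟩ ⟨p, q, e, x, y⟩ =
      ⟨p, q', by omega, x, Q.d hq k ⟨j, by omega⟩ y⟩ := by
  subst hq hj
  refine (dif_neg (by simp)).trans ?_
  simp

theorem TensorCube.d_d {P Q : PrecubicalSet.{u}} {m n r : ℕ} (h : m + 1 = n) (h' : n + 1 = r)
    (k l : Fin 2) (i j : ℕ) (hij : i < j) (hj : j < r) (c : TensorCube P Q r) :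
    TensorCube.d h k ⟨i, by omega⟩ (TensorCube.d h' l ⟨j, hj⟩ c) =
      TensorCube.d h l ⟨j - 1, by omega⟩ (TensorCube.d h' k ⟨i, by omega⟩ c) := by
  obtain ⟨p, q, hpq, x, y⟩ := c
  by_cases hjp : j < p
  · have hp : p - 2 + 1 = p - 1 := by omega
    have hp' : p - 1 + 1 = p := by omega
    rw [d_left h' l j hj hpq x y hp' hjp, d_left h k i _ _ _ _ hp (by omega),
      d_left h' k i _ hpq x y hp' (by omega), d_left h l (j - 1) _ _ _ _ hp (by omega),
      P.d_d _ _ k l i j hij hjp x]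
  · by_cases hip : i < p
    · have hp : p - 1 + 1 = p := by omega
      have hq : q - 1 + 1 = q := by omega
      rw [d_right h' l j hj hpq x y hq (j - p) (by omega), d_left h k i _ _ _ _ hp hip,
        d_left h' k i _ hpq x y hp hip, d_right h l (j - 1) _ _ _ _ hq (j - p) (by omega)]
    · have hq : q - 2 + 1 = q - 1 := by omega
      have hq' : q - 1 + 1 = q := by omega
      rw [d_right h' l j hj hpq x y hq' (j - p) (by omega),
        d_right h k i _ _ _ _ hq (i - p) (by omega),
        d_right h' k i _ hpq x y hq' (i - p) (by omega),
        d_right h l (j - 1) _ _ _ _ hq (j - p - 1) (by omega),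
        Q.d_d _ _ k l (i - p) (j - p) (by omega) (by omega) y]

theorem TensorCube.mk_heq {P Q : PrecubicalSet.{u}} {m n p q : ℕ} (h : m = n) (e : p + q = m)
    (e' : p + q = n) (x : P.cube p) (y : Q.cube q) :
    (⟨p, q, e, x, y⟩ : TensorCube P Q m) ≍ (⟨p, q, e', x, y⟩ : TensorCube P Q n) := by
  subst h
  rfl

/-- The tensor product of precubical sets. -/
def tensor (P Q : PrecubicalSet.{u}) : PrecubicalSet.{u} where
  cube n := TensorCube P Q n
  d h k i c := TensorCube.d h k i c
  d_d := TensorCube.d_d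

/-- The tensor product of morphisms of precubical sets. -/
def Hom.tensor {P P' Q Q' : PrecubicalSet.{u}} (f : Hom P P') (g : Hom Q Q') :
    Hom (P.tensor Q) (P'.tensor Q') where
  app n c := ⟨c.p, c.q, c.deg, f.app _ c.fst, g.app _ c.snd⟩
  map_d := by
    rintro m n h k ⟨i, hi⟩ ⟨p, q, e, x, y⟩
    let F : TensorCube P Q m → TensorCube P' Q' m :=
      fun c => ⟨c.p, c.q, c.deg, f.app _ c.fst, g.app _ c.snd⟩
    by_cases hip : i < p
    · have hp : p - 1 + 1 = p := by omega
      have h1 := TensorCube.d_left h k i hi e x y hp hip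
      have h2 := TensorCube.d_left h k i hi e (f.app _ x) (g.app _ y) hp hip
      rw [← f.map_d] at h2
      exact (congrArg F h1).trans h2.symm
    · have hq : q - 1 + 1 = q := by omega
      have h1 := TensorCube.d_right h k i hi e x y hq (i - p) (by omega)
      have h2 := TensorCube.d_right h k i hi e (f.app _ x) (g.app _ y) hq (i - p) (by omega)
      rw [← g.map_d] at h2
      exact (congrArg F h1).trans h2.symm

/-- The precubical set `⟦0,0⟧` with one vertex and no other cubes. -/
def point : PrecubicalSet.{u} where
  cube n := { _x : PUnit.{u + 1} // n = 0 }
  d h _ _ x := absurd x.2 (by omega)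
  d_d h h' _ _ _ _ _ _ x := absurd x.2 (by omega)

/-- The associativity morphism `(P ⊗ Q) ⊗ R → P ⊗ (Q ⊗ R)`, `((x, y), z) ↦ (x, (y, z))`. -/
def assocHom (P Q R : PrecubicalSet.{u}) :
    Hom ((P.tensor Q).tensor R) (P.tensor (Q.tensor R)) where
  app n c := ⟨c.fst.p, c.fst.q + c.q, by have := c.deg; have := c.fst.deg; omega, c.fst.fst,
    ⟨c.fst.q, c.q, rfl, c.fst.snd, c.snd⟩⟩
  map_d := by
    rintro m n h k ⟨i, hi⟩ ⟨s, r, h1, ⟨p, q, h2, x, y⟩, z⟩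
    subst h2
    let F : TensorCube (P.tensor Q) R m → TensorCube P (Q.tensor R) m := fun c =>
      ⟨c.fst.p, c.fst.q + c.q, by have := c.deg; have := c.fst.deg; omega, c.fst.fst,
        ⟨c.fst.q, c.q, rfl, c.fst.snd, c.snd⟩⟩
    by_cases hs : i < p + q
    · by_cases hp : i < p
      · have hp' : p - 1 + 1 = p := by omega
        have hs' : p - 1 + q + 1 = p + q := by omega
        have e1 := TensorCube.d_left h k i hi h1 (P := P.tensor Q) ⟨p, q, rfl, x, y⟩ z hs' hs
        have e2 := TensorCube.d_left hs' k i hs rfl x y hp' hp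
        have e3 := TensorCube.d_left h k i hi (by omega) (Q := Q.tensor R) x
          ⟨q, r, rfl, y, z⟩ hp' hp
        exact (congrArg F (e1.trans (congrArg (fun c : TensorCube P Q (p - 1 + q) =>
          (⟨p - 1 + q, r, by omega, c, z⟩ : TensorCube (P.tensor Q) R m)) e2))).trans e3.symm
      · have hq' : q - 1 + 1 = q := by omega
        have hs' : p + (q - 1) + 1 = p + q := by omega
        have hr' : q - 1 + r + 1 = q + r := by omega
        have e1 := TensorCube.d_left h k i hi h1 (P := P.tensor Q) ⟨p, q, rfl, x, y⟩ z hs' hs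
        have e2 := TensorCube.d_right hs' k i hs rfl x y hq' (i - p) (by omega)
        have e3 := TensorCube.d_right h k i hi (by omega) (Q := Q.tensor R) x
          ⟨q, r, rfl, y, z⟩ hr' (i - p) (by omega)
        have e4 := TensorCube.d_left hr' k (i - p) (by omega) rfl y z hq' (by omega)
        exact (congrArg F (e1.trans (congrArg (fun c : TensorCube P Q (p + (q - 1)) =>
          (⟨p + (q - 1), r, by omega, c, z⟩ : TensorCube (P.tensor Q) R m)) e2))).trans
          (e3.trans (congrArg (fun c : TensorCube Q R (q - 1 + r) =>
          (⟨p, q - 1 + r, by omega, x, c⟩ : TensorCube P (Q.tensor R) m)) e4)).symm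
    · have hq' : r - 1 + 1 = r := by omega
      have hr' : q + (r - 1) + 1 = q + r := by omega
      have e1 := TensorCube.d_right h k i hi h1 (P := P.tensor Q) ⟨p, q, rfl, x, y⟩ z hq'
        (i - (p + q)) (by omega)
      have e3 := TensorCube.d_right h k i hi (by omega) (Q := Q.tensor R) x
        ⟨q, r, rfl, y, z⟩ hr' (i - p) (by omega)
      have e4 := TensorCube.d_right hr' k (i - p) (by omega) rfl y z hq' (i - (p + q)) (by omega)
      exact (congrArg F e1).trans
        (e3.trans (congrArg (fun c : TensorCube Q R (q + (r - 1)) =>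
        (⟨p, q + (r - 1), by omega, x, c⟩ : TensorCube P (Q.tensor R) m)) e4)).symm

/-- The left unit morphism `⟦0,0⟧ ⊗ P → P`. -/
def leftUnitHom (P : PrecubicalSet.{u}) : Hom (point.tensor P) P where
  app n c := cast (congrArg P.cube (by have := c.deg; have := c.fst.2; omega)) c.snd
  map_d := by
    rintro m n h k ⟨i, hi⟩ ⟨p, q, e, ⟨x, rfl⟩, y⟩
    obtain rfl : q = n := by omega
    subst h
    let F : TensorCube point P m → P.cube m := fun c =>
      cast (congrArg P.cube (by have := c.deg; have := c.fst.2; omega)) c.snd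
    exact congrArg F (TensorCube.d_right rfl k i hi e (P := point) ⟨x, rfl⟩ y rfl i rfl)

/-- The right unit morphism `P ⊗ ⟦0,0⟧ → P`. -/
def rightUnitHom (P : PrecubicalSet.{u}) : Hom (P.tensor point) P where
  app n c := cast (congrArg P.cube (by have := c.deg; have := c.snd.2; omega)) c.fst
  map_d := by
    rintro m n h k ⟨i, hi⟩ ⟨p, q, e, x, ⟨y, rfl⟩⟩
    obtain rfl : p = n := by omega
    subst h
    let F : TensorCube P point m → P.cube m := fun c =>
      cast (congrArg P.cube (by have := c.deg; have := c.snd.2; omega)) c.fst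
    exact congrArg F (TensorCube.d_left rfl k i hi e (Q := point) x ⟨y, rfl⟩ rfl hi)

/-- The inverse of the morphism `(P_{≤ n} ⊗ Q)_{≤ n} → (P ⊗ Q)_{≤ n}`. -/
def skeletonTensorLeftInv (n : ℕ) (P Q : PrecubicalSet.{u}) :
    Hom ((P.tensor Q).skeleton n) (((P.skeleton n).tensor Q).skeleton n) where
  app m c := ⟨⟨c.1.p, c.1.q, c.1.deg, ⟨c.1.fst, by have := c.1.deg; have := c.2; omega⟩, c.1.snd⟩,
    c.2⟩
  map_d {m r} h k i c := by
    let F := (((skeletonIncl n P).tensor (Hom.id Q)).skeleton n)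
    have hF := F.map_d h k i ⟨⟨c.1.p, c.1.q, c.1.deg,
      ⟨c.1.fst, by have := c.1.deg; have := c.2; omega⟩, c.1.snd⟩, c.2⟩
    let G : ((P.tensor Q).skeleton n).cube m → (((P.skeleton n).tensor Q).skeleton n).cube m :=
      fun c => ⟨⟨c.1.p, c.1.q, c.1.deg,
        ⟨c.1.fst, by have := c.1.deg; have := c.2; omega⟩, c.1.snd⟩, c.2⟩
    exact congrArg G hF.symm

/-- The inverse of the morphism `(P ⊗ Q_{≤ n})_{≤ n} → (P ⊗ Q)_{≤ n}`. -/
def skeletonTensorRightInv (n : ℕ) (P Q : PrecubicalSet.{u}) :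
    Hom ((P.tensor Q).skeleton n) ((P.tensor (Q.skeleton n)).skeleton n) where
  app m c := ⟨⟨c.1.p, c.1.q, c.1.deg, c.1.fst, ⟨c.1.snd, by have := c.1.deg; have := c.2; omega⟩⟩,
    c.2⟩
  map_d {m r} h k i c := by
    let F := (((Hom.id P).tensor (skeletonIncl n Q)).skeleton n)
    have hF := F.map_d h k i ⟨⟨c.1.p, c.1.q, c.1.deg, c.1.fst,
      ⟨c.1.snd, by have := c.1.deg; have := c.2; omega⟩⟩, c.2⟩
    let G : ((P.tensor Q).skeleton n).cube m → ((P.tensor (Q.skeleton n)).skeleton n).cube m :=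
      fun c => ⟨⟨c.1.p, c.1.q, c.1.deg, c.1.fst,
        ⟨c.1.snd, by have := c.1.deg; have := c.2; omega⟩⟩, c.2⟩
    exact congrArg G hF.symm

/-- The inverse of the associativity morphism. -/
def assocInv (P Q R : PrecubicalSet.{u}) :
    Hom (P.tensor (Q.tensor R)) ((P.tensor Q).tensor R) where
  app n c := ⟨c.p + c.snd.p, c.snd.q, by have := c.deg; have := c.snd.deg; omega,
    ⟨c.p, c.snd.p, rfl, c.fst, c.snd.fst⟩, c.snd.snd⟩
  map_d {m n} h k i c := by
    let G : ∀ l, TensorCube P (Q.tensor R) l → TensorCube (P.tensor Q) R l := fun l c =>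
      ⟨c.p + c.snd.p, c.snd.q, by have := c.deg; have := c.snd.deg; omega,
        ⟨c.p, c.snd.p, rfl, c.fst, c.snd.fst⟩, c.snd.snd⟩
    have h1 : ∀ l c, (assocHom P Q R).app l (G l c) = c := by
      rintro l ⟨p, s, h1, x, ⟨q, r, rfl, y, z⟩⟩
      rfl
    have h2 : ∀ l c, G l ((assocHom P Q R).app l c) = c := by
      rintro l ⟨s, r, h1, ⟨p, q, rfl, x, y⟩, z⟩
      rfl
    have h3 := (assocHom P Q R).map_d h k i (G n c)
    have h4 := h3.trans (congrArg ((P.tensor (Q.tensor R)).d h k i) (h1 n c))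
    exact (congrArg (G m) h4).symm.trans (h2 m _)

/-- The inverse of the left unit morphism. -/
def leftUnitInv (P : PrecubicalSet.{u}) : Hom P (point.tensor P) where
  app n x := ⟨0, n, by omega, ⟨PUnit.unit, rfl⟩, x⟩
  map_d h l i x :=
    (TensorCube.d_right (P := point) (p := 0) h l i i.2 _ ⟨PUnit.unit, rfl⟩ x h i
      (by omega)).symm

/-- The inverse of the right unit morphism. -/
def rightUnitInv (P : PrecubicalSet.{u}) : Hom P (P.tensor point) where
  app n x := ⟨n, 0, by omega, x, ⟨PUnit.unit, rfl⟩⟩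
  map_d h l i x :=
    (TensorCube.d_left (Q := point) (q := 0) h l i i.2 _ x ⟨PUnit.unit, rfl⟩ h i.2).symm

theorem assocHom_comp_assocInv (P Q R : PrecubicalSet.{u}) :
    (assocHom P Q R).comp (assocInv P Q R) = Hom.id _ := by
  apply Hom.ext
  funext n c
  obtain ⟨s, r, h1, ⟨p, q, rfl, x, y⟩, z⟩ := c
  rfl

theorem assocInv_comp_assocHom (P Q R : PrecubicalSet.{u}) :
    (assocInv P Q R).comp (assocHom P Q R) = Hom.id _ := by
  apply Hom.ext
  funext n c
  obtain ⟨p, s, h1, x, ⟨q, r, rfl, y, z⟩⟩ := c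
  rfl

theorem leftUnitHom_comp_leftUnitInv (P : PrecubicalSet.{u}) :
    (leftUnitHom P).comp (leftUnitInv P) = Hom.id _ := by
  apply Hom.ext
  funext n c
  obtain ⟨p, q, e, ⟨x, rfl⟩, y⟩ := c
  obtain rfl : q = n := by omega
  rfl

theorem rightUnitHom_comp_rightUnitInv (P : PrecubicalSet.{u}) :
    (rightUnitHom P).comp (rightUnitInv P) = Hom.id _ := by
  apply Hom.ext
  funext n c
  obtain ⟨p, q, e, x, ⟨y, rfl⟩⟩ := c
  obtain rfl : p = n := by omega
  rfl

theorem assocHom_comp_leftUnitHom (P Q : PrecubicalSet.{u}) :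
    (assocHom P point Q).comp ((Hom.id P).tensor (leftUnitHom Q)) =
      (rightUnitHom P).tensor (Hom.id Q) := by
  apply Hom.ext
  funext n c
  obtain ⟨s, r, h1, ⟨p, q, h2, x, ⟨u, rfl⟩⟩, y⟩ := c
  obtain rfl : p = s := by omega
  refine TensorCube.ext rfl (Nat.zero_add r) HEq.rfl ?_
  exact cast_heq _ _

theorem leftUnitHom_natural {P Q : PrecubicalSet.{u}} (f : Hom P Q) :
    ((Hom.id point).tensor f).comp (leftUnitHom Q) = (leftUnitHom P).comp f := by
  apply Hom.ext
  funext n c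
  obtain ⟨p, q, e, ⟨x, rfl⟩, y⟩ := c
  obtain rfl : q = n := by omega
  rfl

theorem rightUnitHom_natural {P Q : PrecubicalSet.{u}} (f : Hom P Q) :
    (f.tensor (Hom.id point)).comp (rightUnitHom Q) = (rightUnitHom P).comp f := by
  apply Hom.ext
  funext n c
  obtain ⟨p, q, e, x, ⟨y, rfl⟩⟩ := c
  obtain rfl : p = n := by omega
  rfl

/-! ### Standard cubes -/

/-- The precubical interval `⟦0,1⟧`: vertices `0` and `1`, one edge, and no other cubes. -/
def interval : PrecubicalSet.{u} where
  cube n := match n with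
    | 0 => ULift.{u} (Fin 2)
    | 1 => PUnit.{u + 1}
    | _ + 2 => PEmpty.{u + 1}
  d {m n} h k _ x := match m, n, h, x with
    | 0, _, rfl, _ => ULift.up k
    | _ + 1, _, rfl, x => x.elim
  d_d {m n r} h h' _ _ _ _ _ _ x := by
    subst h h'
    exact x.elim

/-- The vertex `k` of `⟦0,1⟧`. -/
def interval.vertex (k : Fin 2) : interval.{u}.cube 0 := ULift.up k

/-- The edge `[0,1]` of `⟦0,1⟧`. -/
def interval.edge : interval.{u}.cube 1 := PUnit.unit

/-- The precubical `m`-cube `⟦0,1⟧^{⊗ m}`. -/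
def stdCube : ℕ → PrecubicalSet.{u}
  | 0 => point
  | m + 1 => interval.tensor (stdCube m)

/-- The unique `m`-cube `ι_m` of the precubical `m`-cube. -/
def topCube : (m : ℕ) → (stdCube.{u} m).cube m
  | 0 => (⟨PUnit.unit, rfl⟩ : { _x : PUnit.{u + 1} // 0 = 0 })
  | m + 1 => (⟨1, m, by omega, interval.edge, topCube m⟩ : TensorCube interval (stdCube m) (m + 1))

/-- The morphism `P → ⟦0,1⟧ ⊗ P`, `x ↦ (k, x)`. -/
def insertEnd (k : Fin 2) (P : PrecubicalSet.{u}) : Hom P (interval.tensor P) where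
  app n x := ⟨0, n, by omega, interval.vertex k, x⟩
  map_d h l i x :=
    (TensorCube.d_right (P := interval) h l i i.2 _ (interval.vertex k) x h i (by omega)).symm

/-- The morphism `δ^k_i : ⟦0,1⟧^{⊗ m} → ⟦0,1⟧^{⊗ (m + 1)}` inserting `k` at the place `i`. -/
def coface (k : Fin 2) : (m i : ℕ) → i < m + 1 → Hom (stdCube.{u} m) (stdCube (m + 1))
  | m, 0, _ => insertEnd k (stdCube m)
  | m + 1, i + 1, h => (Hom.id interval).tensor (coface k m i (by omega))

theorem coface_comp_coface (k l : Fin 2) : ∀ (m i j : ℕ) (hij : i < j) (hj : j < m + 2),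
    (coface.{u} k m i (by omega)).comp (coface l (m + 1) j hj) =
      (coface l m (j - 1) (by omega)).comp (coface k (m + 1) i (by omega))
  | 0, 0, j + 1, _, hj => rfl
  | m + 1, 0, j + 1, _, hj => rfl
  | 0, i + 1, j, hij, hj => absurd hij (by omega)
  | m + 1, i + 1, j + 2, hij, hj => by
    have ih := coface_comp_coface k l m i (j + 1) (by omega) (by omega)
    exact congrArg (Hom.tensor (Hom.id interval)) ih

theorem d_topCube (k : Fin 2) : ∀ (m i : ℕ) (hi : i < m + 1),
    (stdCube.{u} (m + 1)).d rfl k ⟨i, hi⟩ (topCube (m + 1)) = (coface k m i hi).app m (topCube m)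
  | 0, 0, hi => TensorCube.d_left (P := interval) (Q := stdCube 0) rfl k 0 hi (Nat.add_comm 1 0)
      interval.edge (topCube 0) rfl Nat.zero_lt_one
  | m + 1, 0, hi => TensorCube.d_left (P := interval) (Q := stdCube (m + 1)) rfl k 0 hi
      (Nat.add_comm 1 (m + 1)) interval.edge (topCube (m + 1)) rfl Nat.zero_lt_one
  | m + 1, i + 1, hi =>
    (TensorCube.d_right (P := interval) (Q := stdCube (m + 1)) rfl k (i + 1) hi
      (Nat.add_comm 1 (m + 1))
      interval.edge (topCube (m + 1)) rfl i (by omega)).trans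
    (congrArg (fun c : (stdCube.{u} (m + 1)).cube m =>
      (⟨1, m, by omega, interval.edge, c⟩ : TensorCube interval (stdCube.{u} (m + 1)) (m + 1)))
      (d_topCube k m i (by omega)))

/-! ### Coskeleta -/

/-- The `n`-coskeleton `Γ_n P`: its `m`-cubes are the morphisms `(⟦0,1⟧^{⊗ m})_{≤ n} → P`, and
`d^k_i` is the composition with `δ^k_i`. -/
def coskeleton (n : ℕ) (P : PrecubicalSet.{u}) : PrecubicalSet.{u} where
  cube m := Hom ((stdCube m).skeleton n) P
  d {m r} h k i f := match r, h, i, f with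
    | _, rfl, i, f => ((coface k m i i.2).skeleton n).comp f
  d_d {m r s} h h' k l i j hij hj f := by
    subst h h'
    have e := congrArg (fun g => (Hom.skeleton n g).comp f)
      (coface_comp_coface k l m i j hij (by omega))
    exact e

/-- The morphism induced on `n`-coskeleta. -/
def Hom.coskeleton (n : ℕ) {P Q : PrecubicalSet.{u}} (f : Hom P Q) :
    Hom (P.coskeleton n) (Q.coskeleton n) where
  app _ g := g.comp f
  map_d h k i g := by subst h; rfl

/-- The comparison `(Γ_n P)_m → P_m` for `m ≤ n`, sending `x_♯` to `x`. -/
def coskeletonEval {n : ℕ} {P : PrecubicalSet.{u}} {m : ℕ} (hm : m ≤ n)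
    (f : (P.coskeleton n).cube m) : P.cube m :=
  Hom.app f m ⟨topCube m, hm⟩

theorem d_coskeletonEval {n : ℕ} {P : PrecubicalSet.{u}} {m r : ℕ} (h : m + 1 = r) (hr : r ≤ n)
    (k : Fin 2) (i : Fin r) (f : (P.coskeleton n).cube r) :
    coskeletonEval (by omega) ((P.coskeleton n).d h k i f) = P.d h k i (coskeletonEval hr f) := by
  subst h
  refine Eq.trans ?_ (Hom.map_d f rfl k i ⟨topCube (m + 1), hr⟩)
  exact congrArg (Hom.app f m) (Subtype.ext (d_topCube k m i i.2).symm)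

/-- The morphism `x_♯` for a vertex `x`. -/
def ofVertex {P : PrecubicalSet.{u}} (x : P.cube 0) : Hom (stdCube 0) P where
  app _ c := cast (congrArg P.cube c.2.symm) x
  map_d h _ _ c := absurd c.2 (by omega)

/-- The morphism `⟦0,1⟧ → P` given by an edge. -/
def ofInterval {P : PrecubicalSet.{u}} (x : P.cube 1) : Hom interval P where
  app n c := match n, c with
    | 0, k => P.d rfl k.down 0 x
    | 1, _ => x
    | _ + 2, c => c.elim
  map_d {m n} h _ i c := match m, n, h, i, c with
    | 0, _, rfl, 0, _ => rfl
    | _ + 1, _, rfl, _, c => c.elim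

/-- The morphism `x_♯` for an edge `x`. -/
def ofEdge {P : PrecubicalSet.{u}} (x : P.cube 1) : Hom (stdCube 1) P :=
  (rightUnitHom interval).comp (ofInterval x)

theorem coskeletonEval_zero_injective {n : ℕ} {P : PrecubicalSet.{u}} :
    Function.Injective (coskeletonEval (n := n) (P := P) (Nat.zero_le n)) := by
  intro f g e
  apply Hom.ext
  funext m c
  obtain ⟨⟨x, rfl⟩, hc⟩ := c
  exact e

theorem coskeletonEval_one_injective {n : ℕ} {P : PrecubicalSet.{u}} (hn : 1 ≤ n) :
    Function.Injective (coskeletonEval (n := n) (P := P) hn) := by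
  intro f g e
  apply Hom.ext
  funext m c
  obtain ⟨⟨p, q, e', x, ⟨y, rfl⟩⟩, hc⟩ := c
  obtain rfl : p = m := by omega
  match p, x, e', hc with
  | 0, ULift.up k, _, hc =>
    have h1 : (⟨⟨0, 0, rfl, ULift.up k, ⟨y, rfl⟩⟩, hc⟩ : ((stdCube 1).skeleton n).cube 0) =
        ((stdCube 1).skeleton n).d rfl k 0 ⟨topCube 1, hn⟩ :=
      Subtype.ext (d_topCube k 0 0 Nat.zero_lt_one).symm
    refine (congrArg (Hom.app f 0) h1).trans (Eq.trans ?_ (congrArg (Hom.app g 0) h1).symm)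
    exact (Hom.map_d f rfl k 0 _).trans
      ((congrArg (P.d rfl k 0) e).trans (Hom.map_d g rfl k 0 _).symm)
  | 1, _, _, _ => exact e
  | _ + 2, x, _, _ => exact x.elim

end PrecubicalSet

open PrecubicalSet

/-! ### Higher-dimensional automata -/

/-- A higher-dimensional automaton. -/
structure HDA where
  /-- the underlying precubical set -/
  pcs : PrecubicalSet.{u}
  /-- the initial state -/
  init : pcs.cube 0
  /-- the final states -/
  final : Set (pcs.cube 0)
  /-- the set of labels -/
  Label : Type v
  /-- the labeling function -/
  label : pcs.cube 1 → Label
  label_d : ∀ (i : Fin 2) (x : pcs.cube 2), label (pcs.d rfl 0 i x) = label (pcs.d rfl 1 i x)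

namespace HDA

/-- Morphisms of HDAs. -/
@[ext]
structure Hom (A B : HDA.{u, v}) where
  /-- the map of cubes -/
  map : PrecubicalSet.Hom A.pcs B.pcs
  /-- the map of labels -/
  onLabel : A.Label → B.Label
  map_init : map.app 0 A.init = B.init
  map_final : ∀ x ∈ A.final, map.app 0 x ∈ B.final
  label_map : ∀ x : A.pcs.cube 1, B.label (map.app 1 x) = onLabel (A.label x)

/-- The category of HDAs. -/
instance : Category HDA.{u, v} where
  Hom := HDA.Hom
  id A := ⟨PrecubicalSet.Hom.id A.pcs, fun a => a, rfl, fun _ h => h, fun _ => rfl⟩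
  comp f g := ⟨f.map.comp g.map, fun a => g.onLabel (f.onLabel a),
    (congrArg (g.map.app 0) f.map_init).trans g.map_init,
    fun x hx => g.map_final _ (f.map_final x hx),
    fun x => (g.label_map _).trans (congrArg g.onLabel (f.label_map x))⟩

/-- An HDA is extensional if any two edges with the same label and the same initial and final
vertices are equal. -/
def IsExtensional : ObjectProperty HDA.{u, v} := fun A =>
  ∀ x y : A.pcs.cube 1, A.label x = A.label y → A.pcs.d rfl 0 0 x = A.pcs.d rfl 0 0 y →
    A.pcs.d rfl 1 0 x = A.pcs.d rfl 1 0 y → x = y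

/-- The `n`-skeleton of an HDA. -/
def skeleton (n : ℕ) (A : HDA.{u, v}) : HDA.{u, v} where
  pcs := A.pcs.skeleton n
  init := ⟨A.init, Nat.zero_le n⟩
  final := { x | x.1 ∈ A.final }
  Label := A.Label
  label x := A.label x.1
  label_d i x := A.label_d i x.1

/-- The morphism induced on `n`-skeleta. -/
def skeletonMap (n : ℕ) {A B : HDA.{u, v}} (f : A ⟶ B) : A.skeleton n ⟶ B.skeleton n where
  map := f.map.skeleton n
  onLabel := f.onLabel
  map_init := Subtype.ext f.map_init
  map_final x hx := f.map_final x.1 hx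
  label_map x := f.label_map x.1

/-- The labeling function of `A ⊗ B`. -/
def tensorLabel (A B : HDA.{u, v}) : TensorCube A.pcs B.pcs 1 → A.Label ⊕ B.Label
  | ⟨1, 0, _, x, _⟩ => Sum.inl (A.label x)
  | ⟨0, 1, _, _, y⟩ => Sum.inr (B.label y)
  | ⟨0, 0, h, _, _⟩ => absurd h (by omega)
  | ⟨0, _ + 2, h, _, _⟩ => absurd h (by omega)
  | ⟨1, _ + 1, h, _, _⟩ => absurd h (by omega)
  | ⟨_ + 2, _, h, _, _⟩ => absurd h (by omega)

/-- The tensor product of HDAs. -/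
def tensor (A B : HDA.{u, v}) : HDA.{u, v} where
  pcs := A.pcs.tensor B.pcs
  init := ⟨0, 0, rfl, A.init, B.init⟩
  final := { c | ∃ x ∈ A.final, ∃ y ∈ B.final, c = ⟨0, 0, rfl, x, y⟩ }
  Label := A.Label ⊕ B.Label
  label := tensorLabel A B
  label_d i c := by
    obtain ⟨p, q, e, x, y⟩ := c
    match p, q, e, x, y, i with
    | 2, 0, _, x, y, 0 => exact congrArg Sum.inl (A.label_d 0 x)
    | 2, 0, _, x, y, 1 => exact congrArg Sum.inl (A.label_d 1 x)
    | 0, 2, _, x, y, 0 => exact congrArg Sum.inr (B.label_d 0 y)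
    | 0, 2, _, x, y, 1 => exact congrArg Sum.inr (B.label_d 1 y)
    | 1, 1, _, x, y, 0 => rfl
    | 1, 1, _, x, y, 1 => rfl
    | 0, 0, h, _, _, _ => exact absurd h (by omega)
    | 0, 1, h, _, _, _ => exact absurd h (by omega)
    | 0, _ + 3, h, _, _, _ => exact absurd h (by omega)
    | 1, 0, h, _, _, _ => exact absurd h (by omega)
    | 1, _ + 2, h, _, _, _ => exact absurd h (by omega)
    | 2, _ + 1, h, _, _, _ => exact absurd h (by omega)
    | _ + 3, _, h, _, _, _ => exact absurd h (by omega)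

/-- The unit HDA: one vertex, which is initial and final, and no labels. -/
def unit : HDA.{u, v} where
  pcs := point
  init := ⟨PUnit.unit, rfl⟩
  final := Set.univ
  Label := PEmpty
  label x := absurd x.2 one_ne_zero
  label_d _ x := absurd x.2 two_ne_zero

/-- The tensor product of morphisms of HDAs. -/
def tensorMap {A A' B B' : HDA.{u, v}} (f : A ⟶ A') (g : B ⟶ B') :
    A.tensor B ⟶ A'.tensor B' where
  map := f.map.tensor g.map
  onLabel := Sum.map f.onLabel g.onLabel
  map_init := by
    show (⟨0, 0, rfl, f.map.app 0 A.init, g.map.app 0 B.init⟩ : TensorCube A'.pcs B'.pcs 0) = _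
    rw [f.map_init, g.map_init]
    rfl
  map_final := by
    rintro _ ⟨x, hx, y, hy, rfl⟩
    exact ⟨_, f.map_final x hx, _, g.map_final y hy, rfl⟩
  label_map c := by
    obtain ⟨p, q, e, x, y⟩ := c
    match p, q, e, x, y with
    | 1, 0, _, x, y => exact congrArg Sum.inl (f.label_map x)
    | 0, 1, _, x, y => exact congrArg Sum.inr (g.label_map y)
    | 0, 0, h, _, _ => exact absurd h (by omega)
    | 0, _ + 2, h, _, _ => exact absurd h (by omega)
    | 1, _ + 1, h, _, _ => exact absurd h (by omega)
    | _ + 2, _, h, _, _ => exact absurd h (by omega)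

/-- The associativity isomorphism of HDAs. -/
def assoc (A B C : HDA.{u, v}) :
    (A.tensor B).tensor C ≅ A.tensor (B.tensor C) where
  hom :=
    { map := assocHom A.pcs B.pcs C.pcs
      onLabel := Equiv.sumAssoc A.Label B.Label C.Label
      map_init := rfl
      map_final := by
        rintro _ ⟨_, ⟨x, hx, y, hy, rfl⟩, z, hz, rfl⟩
        exact ⟨x, hx, _, ⟨y, hy, z, hz, rfl⟩, rfl⟩
      label_map := by
        rintro ⟨s, r, h1, ⟨p, q, h2, x, y⟩, z⟩
        subst h2
        obtain ⟨rfl, rfl, rfl⟩ | ⟨rfl, rfl, rfl⟩ | ⟨rfl, rfl, rfl⟩ :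
          (p = 1 ∧ q = 0 ∧ r = 0) ∨ (p = 0 ∧ q = 1 ∧ r = 0) ∨ (p = 0 ∧ q = 0 ∧ r = 1) := by omega
        all_goals rfl }
  inv :=
    { map := assocInv A.pcs B.pcs C.pcs
      onLabel := (Equiv.sumAssoc A.Label B.Label C.Label).symm
      map_init := rfl
      map_final := by
        rintro _ ⟨x, hx, _, ⟨y, hy, z, hz, rfl⟩, rfl⟩
        exact ⟨_, ⟨x, hx, y, hy, rfl⟩, z, hz, rfl⟩
      label_map := by
        rintro ⟨p, s, h1, x, ⟨q, r, h2, y, z⟩⟩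
        subst h2
        obtain ⟨rfl, rfl, rfl⟩ | ⟨rfl, rfl, rfl⟩ | ⟨rfl, rfl, rfl⟩ :
          (p = 1 ∧ q = 0 ∧ r = 0) ∨ (p = 0 ∧ q = 1 ∧ r = 0) ∨ (p = 0 ∧ q = 0 ∧ r = 1) := by omega
        all_goals rfl }
  hom_inv_id := HDA.Hom.ext (assocHom_comp_assocInv _ _ _)
    (funext (Equiv.sumAssoc A.Label B.Label C.Label).symm_apply_apply)
  inv_hom_id := HDA.Hom.ext (assocInv_comp_assocHom _ _ _)
    (funext (Equiv.sumAssoc A.Label B.Label C.Label).apply_symm_apply)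

/-- The left unit isomorphism of HDAs. -/
def leftUnit (A : HDA.{u, v}) : unit.tensor A ≅ A where
  hom :=
    { map := leftUnitHom A.pcs
      onLabel := Sum.elim PEmpty.elim fun a => a
      map_init := rfl
      map_final := by
        rintro _ ⟨x, hx, y, hy, rfl⟩
        exact hy
      label_map := by
        rintro ⟨p, q, e, ⟨x, rfl⟩, y⟩
        obtain rfl : q = 1 := by omega
        rfl }
  inv :=
    { map := leftUnitInv A.pcs
      onLabel := Sum.inr
      map_init := rfl
      map_final := fun x hx => ⟨_, Set.mem_univ _, x, hx, rfl⟩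
      label_map := fun _ => rfl }
  hom_inv_id := HDA.Hom.ext (leftUnitHom_comp_leftUnitInv _)
    (funext fun a => match a with | Sum.inr _ => rfl)
  inv_hom_id := rfl

/-- The right unit isomorphism of HDAs. -/
def rightUnit (A : HDA.{u, v}) : A.tensor unit ≅ A where
  hom :=
    { map := rightUnitHom A.pcs
      onLabel := Sum.elim (fun a => a) PEmpty.elim
      map_init := rfl
      map_final := by
        rintro _ ⟨x, hx, y, hy, rfl⟩
        exact hx
      label_map := by
        rintro ⟨p, q, e, x, ⟨y, rfl⟩⟩
        obtain rfl : p = 1 := by omega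
        rfl }
  inv :=
    { map := rightUnitInv A.pcs
      onLabel := Sum.inl
      map_init := rfl
      map_final := fun x hx => ⟨x, hx, _, Set.mem_univ _, rfl⟩
      label_map := fun _ => rfl }
  hom_inv_id := HDA.Hom.ext (rightUnitHom_comp_rightUnitInv _)
    (funext fun a => match a with | Sum.inl _ => rfl)
  inv_hom_id := rfl

instance : MonoidalCategoryStruct HDA.{u, v} where
  tensorObj := tensor
  whiskerLeft A _ _ f := tensorMap (𝟙 A) f
  whiskerRight f B := tensorMap f (𝟙 B)
  tensorHom := tensorMap
  tensorUnit := unit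
  associator := assoc
  leftUnitor := leftUnit
  rightUnitor := rightUnit

/-- The monoidal category of HDAs. -/
instance : MonoidalCategory HDA.{u, v} := MonoidalCategory.ofTensorHom
  (id_tensorHom_id := fun _ _ => HDA.Hom.ext rfl (funext fun a => by cases a <;> rfl))
  (id_tensorHom := fun _ _ _ _ => rfl)
  (tensorHom_id := fun _ _ => rfl)
  (tensorHom_comp_tensorHom := fun _ _ _ _ =>
    HDA.Hom.ext rfl (funext fun a => by cases a <;> rfl))
  (associator_naturality := fun _ _ _ =>
    HDA.Hom.ext rfl (funext fun a => by rcases a with (_ | _) | _ <;> rfl))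
  (leftUnitor_naturality := fun f =>
    HDA.Hom.ext (leftUnitHom_natural f.map)
      (funext fun a => by rcases a with a | _ <;> first | rfl | exact a.elim))
  (rightUnitor_naturality := fun f =>
    HDA.Hom.ext (rightUnitHom_natural f.map)
      (funext fun a => by rcases a with _ | a <;> first | rfl | exact a.elim))
  (pentagon := fun _ _ _ _ =>
    HDA.Hom.ext (PrecubicalSet.Hom.ext (by
      funext n c
      obtain ⟨s, r, h1, ⟨t, q, rfl, ⟨p, o, rfl, x, y⟩, z⟩, w⟩ := c
      exact TensorCube.ext rfl (Nat.add_assoc _ _ _) HEq.rfl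
        (TensorCube.mk_heq (Nat.add_assoc _ _ _) _ _ _ _)))
      (funext fun a => by rcases a with ((_ | _) | _) | _ <;> rfl))
  (triangle := fun _ _ =>
    HDA.Hom.ext (assocHom_comp_leftUnitHom _ _)
      (funext fun a => by rcases a with (_ | a) | _ <;> first | rfl | exact a.elim))

instance : (IsExtensional.{u, v}).IsMonoidal where
  prop_unit x := absurd x.2 one_ne_zero
  prop_tensor A B hA hB := by
    rintro ⟨p, q, e, x, y⟩ ⟨p', q', e', x', y'⟩ hl h0 h1
    obtain ⟨rfl, rfl⟩ | ⟨rfl, rfl⟩ : (p = 1 ∧ q = 0) ∨ (p = 0 ∧ q = 1) := by omega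
    · obtain ⟨rfl, rfl⟩ | ⟨rfl, rfl⟩ : (p' = 1 ∧ q' = 0) ∨ (p' = 0 ∧ q' = 1) := by omega
      · have h0' : (⟨0, 0, rfl, A.pcs.d rfl 0 0 x, y⟩ : TensorCube A.pcs B.pcs 0) =
          ⟨0, 0, rfl, A.pcs.d rfl 0 0 x', y'⟩ := h0
        have h1' : (⟨0, 0, rfl, A.pcs.d rfl 1 0 x, y⟩ : TensorCube A.pcs B.pcs 0) =
          ⟨0, 0, rfl, A.pcs.d rfl 1 0 x', y'⟩ := h1
        injection h0' with _ _ h2 h3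
        injection h1' with _ _ h4 h5
        obtain rfl := hA x x' (Sum.inl_injective hl) h2 h4
        subst h3
        rfl
      · exact absurd hl Sum.inl_ne_inr
    · obtain ⟨rfl, rfl⟩ | ⟨rfl, rfl⟩ : (p' = 1 ∧ q' = 0) ∨ (p' = 0 ∧ q' = 1) := by omega
      · exact absurd hl Sum.inr_ne_inl
      · have h0' : (⟨0, 0, rfl, x, B.pcs.d rfl 0 0 y⟩ : TensorCube A.pcs B.pcs 0) =
          ⟨0, 0, rfl, x', B.pcs.d rfl 0 0 y'⟩ := h0
        have h1' : (⟨0, 0, rfl, x, B.pcs.d rfl 1 0 y⟩ : TensorCube A.pcs B.pcs 0) =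
          ⟨0, 0, rfl, x', B.pcs.d rfl 1 0 y'⟩ := h1
        injection h0' with _ _ h2 h3
        injection h1' with _ _ h4 h5
        obtain rfl := hB y y' (Sum.inr_injective hl) h3 h5
        subst h2
        rfl

/-- The `n`-truncated extensional HDAs. -/
def IsExtensionalTruncated (n : ℕ) : ObjectProperty HDA.{u, v} := fun A =>
  A.IsExtensional ∧ A.pcs.IsTruncated n

/-- The isomorphism induced on `n`-skeleta. -/
def skeletonIso (n : ℕ) {A B : HDA.{u, v}} (e : A ≅ B) : A.skeleton n ≅ B.skeleton n where
  hom := skeletonMap n e.hom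
  inv := skeletonMap n e.inv
  hom_inv_id := congrArg (skeletonMap n) e.hom_inv_id
  inv_hom_id := congrArg (skeletonMap n) e.inv_hom_id

/-- The inclusion of the `n`-skeleton. -/
def skeletonIncl (n : ℕ) (A : HDA.{u, v}) : A.skeleton n ⟶ A where
  map := A.pcs.skeletonIncl n
  onLabel a := a
  map_init := rfl
  map_final _ hx := hx
  label_map _ := rfl

/-- An `n`-truncated HDA is its own `n`-skeleton. -/
def skeletonTruncated (n : ℕ) (A : HDA.{u, v}) (hA : A.pcs.IsTruncated n) : A.skeleton n ≅ A where
  hom := skeletonIncl n A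
  inv :=
    { map :=
        { app := fun m x => ⟨x, not_lt.1 fun h => (hA m h).elim x⟩
          map_d := fun _ _ _ _ => rfl }
      onLabel := fun a => a
      map_init := rfl
      map_final := fun _ hx => hx
      label_map := fun _ => rfl }
  hom_inv_id := rfl
  inv_hom_id := rfl

/-- `(A_{≤ n} ⊗ B)_{≤ n} = (A ⊗ B)_{≤ n}`. -/
def skeletonTensorLeft (n : ℕ) (A B : HDA.{u, v}) :
    ((A.skeleton n).tensor B).skeleton n ≅ (A.tensor B).skeleton n where
  hom := skeletonMap n (tensorMap (skeletonIncl n A) (𝟙 B))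
  inv :=
    { map := skeletonTensorLeftInv n A.pcs B.pcs
      onLabel := fun a => a
      map_init := rfl
      map_final := by
        rintro ⟨_, hm⟩ ⟨x, hx, y, hy, rfl⟩
        exact ⟨⟨x, Nat.zero_le n⟩, hx, y, hy, rfl⟩
      label_map := by
        rintro ⟨⟨p, q, e, x, y⟩, hm⟩
        obtain ⟨rfl, rfl⟩ | ⟨rfl, rfl⟩ : (p = 1 ∧ q = 0) ∨ (p = 0 ∧ q = 1) := by omega
        all_goals rfl }
  hom_inv_id := HDA.Hom.ext rfl (funext fun a => by cases a <;> rfl)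
  inv_hom_id := HDA.Hom.ext rfl (funext fun a => by cases a <;> rfl)

/-- `(A ⊗ B_{≤ n})_{≤ n} = (A ⊗ B)_{≤ n}`. -/
def skeletonTensorRight (n : ℕ) (A B : HDA.{u, v}) :
    (A.tensor (B.skeleton n)).skeleton n ≅ (A.tensor B).skeleton n where
  hom := skeletonMap n (tensorMap (𝟙 A) (skeletonIncl n B))
  inv :=
    { map := skeletonTensorRightInv n A.pcs B.pcs
      onLabel := fun a => a
      map_init := rfl
      map_final := by
        rintro ⟨_, hm⟩ ⟨x, hx, y, hy, rfl⟩
        exact ⟨x, hx, ⟨y, Nat.zero_le n⟩, hy, rfl⟩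
      label_map := by
        rintro ⟨⟨p, q, e, x, y⟩, hm⟩
        obtain ⟨rfl, rfl⟩ | ⟨rfl, rfl⟩ : (p = 1 ∧ q = 0) ∨ (p = 0 ∧ q = 1) := by omega
        all_goals rfl }
  hom_inv_id := HDA.Hom.ext rfl (funext fun a => by cases a <;> rfl)
  inv_hom_id := HDA.Hom.ext rfl (funext fun a => by cases a <;> rfl)

/-- The 2-coskeleton of an HDA. -/
def coskeleton (A : HDA.{u, v}) : HDA.{u, v} where
  pcs := A.pcs.coskeleton 2
  init := ((stdCube 0).skeletonIncl 2).comp (ofVertex A.init)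
  final := { x | coskeletonEval (Nat.zero_le 2) x ∈ A.final }
  Label := A.Label
  label x := A.label (coskeletonEval one_le_two x)
  label_d i x := by
    rw [d_coskeletonEval rfl le_rfl, d_coskeletonEval rfl le_rfl]
    exact A.label_d i _

/-- The morphism induced on 2-coskeleta. -/
def coskeletonMap {A B : HDA.{u, v}} (f : A ⟶ B) : A.coskeleton ⟶ B.coskeleton where
  map := f.map.coskeleton 2
  onLabel := f.onLabel
  map_init := coskeletonEval_zero_injective f.map_init
  map_final x hx := f.map_final _ hx
  label_map x := f.label_map _

theorem coskeleton_isExtensional (A : HDA.{u, v}) (hA : A.IsExtensional) :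
    A.coskeleton.IsExtensional := by
  intro x y hl h0 h1
  apply coskeletonEval_one_injective one_le_two
  apply hA _ _ hl
  · exact (d_coskeletonEval rfl one_le_two 0 0 x).symm.trans
      ((congrArg (coskeletonEval (Nat.zero_le 2)) h0).trans
        (d_coskeletonEval rfl one_le_two 0 0 y))
  · exact (d_coskeletonEval rfl one_le_two 1 0 x).symm.trans
      ((congrArg (coskeletonEval (Nat.zero_le 2)) h1).trans
        (d_coskeletonEval rfl one_le_two 1 0 y))

/-- The 1-skeleton of the 2-coskeleton of `A` is the 1-skeleton of `A`. -/
def skeletonCoskeleton (A : HDA.{u, v}) : A.coskeleton.skeleton 1 ≅ A.skeleton 1 where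
  hom :=
    { map :=
        { app := fun _ x => ⟨coskeletonEval (x.2.trans one_le_two) x.1, x.2⟩
          map_d := fun h k i x =>
            Subtype.ext (d_coskeletonEval h (x.2.trans one_le_two) k i x.1) }
      onLabel := fun a => a
      map_init := rfl
      map_final := fun _ hx => hx
      label_map := fun _ => rfl }
  inv :=
    { map :=
        { app := fun m x => match m, x with
            | 0, x => ⟨((stdCube 0).skeletonIncl 2).comp (ofVertex x.1), Nat.zero_le 1⟩
            | 1, x => ⟨((stdCube 1).skeletonIncl 2).comp (ofEdge x.1), le_rfl⟩
            | _ + 2, x => absurd x.2 (by omega)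
          map_d := fun {m n} h k i x => match m, n, h, i, x with
            | 0, _, rfl, 0, x => Subtype.ext (coskeletonEval_zero_injective
                (d_coskeletonEval (P := A.pcs) (n := 2) (m := 0) rfl one_le_two k 0
                  (((stdCube 1).skeletonIncl 2).comp (ofEdge x.1))).symm)
            | _ + 1, _, rfl, _, x => absurd x.2 (by omega) }
      onLabel := fun a => a
      map_init := rfl
      map_final := fun _ hx => hx
      label_map := fun _ => rfl }
  hom_inv_id := HDA.Hom.ext (PrecubicalSet.Hom.ext (by
    funext m x
    match m, x with
    | 0, x => exact Subtype.ext (coskeletonEval_zero_injective rfl)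
    | 1, x => exact Subtype.ext (coskeletonEval_one_injective one_le_two rfl)
    | _ + 2, x => exact absurd x.2 (by omega))) rfl
  inv_hom_id := HDA.Hom.ext (PrecubicalSet.Hom.ext (by
    funext m x
    match m, x with
    | 0, _ => rfl
    | 1, _ => rfl
    | _ + 2, x => exact absurd x.2 (by omega))) rfl

end HDA

/-- The category of extensional HDAs. -/
abbrev HDAext : Type (max (u + 1) (v + 1)) := (HDA.IsExtensional.{u, v}).FullSubcategory

/-- The category of 2-truncated extensional HDAs. -/
abbrev HDAext₂ : Type (max (u + 1) (v + 1)) := (HDA.IsExtensionalTruncated.{u, v} 2).FullSubcategory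

/-- The functor `Γ₂`, from 2-truncated extensional HDAs to extensional HDAs. -/
def Gamma₂ : HDAext₂.{u, v} ⥤ HDAext.{u, v} where
  obj A := ⟨A.obj.coskeleton, A.obj.coskeleton_isExtensional A.property.1⟩
  map f := ObjectProperty.homMk (HDA.coskeletonMap f.hom)

/-! ### `⋉`-transition systems -/

/-- A `⋉`-transition system: a transition system (that is, a 1-truncated extensional HDA) with a
relation on its set of labels. -/
structure LtimesTS where
  /-- the underlying transition system -/
  U : HDA.{u, v}
  isExtensionalTruncated : U.IsExtensionalTruncated 1
  /-- the relation `⋉` -/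
  rel : U.Label → U.Label → Prop

namespace LtimesTS

/-- Morphisms of `⋉`-transition systems. -/
@[ext]
structure Hom (S T : LtimesTS.{u, v}) where
  /-- the morphism of underlying transition systems -/
  onU : S.U ⟶ T.U
  rel_map : ∀ a b : S.U.Label, S.rel a b → T.rel (onU.onLabel a) (onU.onLabel b)

/-- The category of `⋉`-transition systems. -/
instance : Category LtimesTS.{u, v} where
  Hom := LtimesTS.Hom
  id S := ⟨𝟙 S.U, fun _ _ h => h⟩
  comp f g := ⟨f.onU ≫ g.onU, fun _ _ h => g.rel_map _ _ (f.rel_map _ _ h)⟩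

/-- An isomorphism of underlying transition systems that preserves and reflects `⋉`. -/
def isoMk {S T : LtimesTS.{u, v}} (e : S.U ≅ T.U)
    (h : ∀ a b, S.rel a b ↔ T.rel (e.hom.onLabel a) (e.hom.onLabel b)) : S ≅ T where
  hom := ⟨e.hom, fun a b => (h a b).1⟩
  inv := ⟨e.inv, fun a b hab => by
    have key : ∀ c, e.hom.onLabel (e.inv.onLabel c) = c := fun c =>
      congrFun (congrArg HDA.Hom.onLabel e.inv_hom_id) c
    rw [h, key, key]
    exact hab⟩
  hom_inv_id := LtimesTS.Hom.ext e.hom_inv_id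
  inv_hom_id := LtimesTS.Hom.ext e.inv_hom_id

/-- The relation on the labels of an interleaving. -/
def interleaveRel {L M : Type v} (r : L → L → Prop) (s : M → M → Prop) : L ⊕ M → L ⊕ M → Prop
  | Sum.inl a, Sum.inl b => r a b
  | Sum.inr a, Sum.inr b => s a b
  | Sum.inl _, Sum.inr _ => True
  | Sum.inr _, Sum.inl _ => False

/-- The interleaving of two `⋉`-transition systems. -/
def interleave (S T : LtimesTS.{u, v}) : LtimesTS.{u, v} where
  U := (S.U ⊗ T.U).skeleton 1
  isExtensionalTruncated := by
    refine ⟨fun x y hl h0 h1 => Subtype.ext ?_, fun m hm => ⟨fun x => absurd x.2 (by omega)⟩⟩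
    have hE : (S.U ⊗ T.U).IsExtensional :=
      ObjectProperty.prop_tensor S.isExtensionalTruncated.1 T.isExtensionalTruncated.1
    exact hE x.1 y.1 hl (congrArg Subtype.val h0) (congrArg Subtype.val h1)
  rel := interleaveRel S.rel T.rel

/-- The interleaving of morphisms. -/
def interleaveMap {S S' T T' : LtimesTS.{u, v}} (f : S ⟶ S') (g : T ⟶ T') :
    S.interleave T ⟶ S'.interleave T' where
  onU := HDA.skeletonMap 1 (f.onU ⊗ₘ g.onU)
  rel_map a b h := match a, b, h with
    | Sum.inl a, Sum.inl b, h => f.rel_map a b h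
    | Sum.inr a, Sum.inr b, h => g.rel_map a b h
    | Sum.inl _, Sum.inr _, _ => trivial

/-- The unit: one vertex and no labels. -/
def unit : LtimesTS.{u, v} where
  U := 𝟙_ HDA
  isExtensionalTruncated :=
    ⟨HDA.IsExtensional.prop_unit, fun m hm => ⟨fun x => absurd x.2 (by omega)⟩⟩
  rel a _ := a.elim

/-- The associativity isomorphism for the interleaving. -/
def assoc (S T R : LtimesTS.{u, v}) :
    (S.interleave T).interleave R ≅ S.interleave (T.interleave R) :=
  isoMk (HDA.skeletonTensorLeft 1 (S.U ⊗ T.U) R.U ≪≫ HDA.skeletonIso 1 (α_ S.U T.U R.U) ≪≫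
    (HDA.skeletonTensorRight 1 S.U (T.U ⊗ R.U)).symm) (by
      rintro ((a | a) | a) ((b | b) | b) <;> exact Iff.rfl)

/-- The left unit isomorphism for the interleaving. -/
def leftUnit (S : LtimesTS.{u, v}) : unit.interleave S ≅ S :=
  isoMk (HDA.skeletonIso 1 (λ_ S.U) ≪≫ HDA.skeletonTruncated 1 S.U S.isExtensionalTruncated.2) (by
    rintro (a | a) (b | b)
    · exact a.elim
    · exact a.elim
    · exact b.elim
    · exact Iff.rfl)

/-- The right unit isomorphism for the interleaving. -/
def rightUnit (S : LtimesTS.{u, v}) : S.interleave unit ≅ S :=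
  isoMk (HDA.skeletonIso 1 (ρ_ S.U) ≪≫ HDA.skeletonTruncated 1 S.U S.isExtensionalTruncated.2) (by
    rintro (a | a) (b | b)
    · exact Iff.rfl
    · exact b.elim
    · exact a.elim
    · exact a.elim)

instance : MonoidalCategoryStruct LtimesTS.{u, v} where
  tensorObj := interleave
  whiskerLeft S _ _ f := interleaveMap (𝟙 S) f
  whiskerRight f T := interleaveMap f (𝟙 T)
  tensorHom := interleaveMap
  tensorUnit := unit
  associator := assoc
  leftUnitor := leftUnit
  rightUnitor := rightUnit

/-- The monoidal category of `⋉`-transition systems with the interleaving. -/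
instance : MonoidalCategory LtimesTS.{u, v} := MonoidalCategory.ofTensorHom
  (id_tensorHom_id := fun _ _ => LtimesTS.Hom.ext
    (HDA.Hom.ext rfl (funext fun a => by cases a <;> rfl)))
  (id_tensorHom := fun _ _ _ _ => rfl)
  (tensorHom_id := fun _ _ => rfl)
  (tensorHom_comp_tensorHom := fun _ _ _ _ => LtimesTS.Hom.ext
    (HDA.Hom.ext rfl (funext fun a => by cases a <;> rfl)))
  (associator_naturality := fun _ _ _ => LtimesTS.Hom.ext
    (HDA.Hom.ext rfl (funext fun a => by rcases a with (_ | _) | _ <;> rfl)))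
  (leftUnitor_naturality := fun f => LtimesTS.Hom.ext
    (HDA.Hom.ext (congrArg (PrecubicalSet.Hom.comp (PrecubicalSet.skeletonIncl 1 _))
      (leftUnitHom_natural f.onU.map))
      (funext fun a => by rcases a with a | _ <;> first | rfl | exact a.elim)))
  (rightUnitor_naturality := fun f => LtimesTS.Hom.ext
    (HDA.Hom.ext (congrArg (PrecubicalSet.Hom.comp (PrecubicalSet.skeletonIncl 1 _))
      (rightUnitHom_natural f.onU.map))
      (funext fun a => by rcases a with _ | a <;> first | rfl | exact a.elim)))
  (pentagon := fun W X Y Z => LtimesTS.Hom.ext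
    (HDA.Hom.ext (PrecubicalSet.Hom.ext (by
      funext n c
      obtain ⟨⟨s, r, h1, ⟨⟨t, q, h2, ⟨⟨p, o, h3, x, y⟩, h4⟩, z⟩, h5⟩, w⟩, h6⟩ := c
      subst h3 h2
      apply Subtype.ext
      have h7 : q + r ≤ 1 := by omega
      have h8 := TensorCube.mk_heq (P := X.U.pcs) (Q := (Y.U.pcs.tensor Z.U.pcs).skeleton 1)
        (Nat.add_assoc o q r) (Nat.add_assoc o q r).symm rfl y ⟨⟨q, r, rfl, z, w⟩, h7⟩
      exact TensorCube.ext rfl (Nat.add_assoc o q r) HEq.rfl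
        (skeleton_mk_heq (n := 1) (P := X.U.pcs.tensor ((Y.U.pcs.tensor Z.U.pcs).skeleton 1))
          (Nat.add_assoc o q r) (by omega) (by omega) h8)))
      (funext fun a => by rcases a with ((_ | _) | _) | _ <;> rfl)))
  (triangle := fun S T => LtimesTS.Hom.ext
    (HDA.Hom.ext (PrecubicalSet.Hom.ext (by
      funext n c
      obtain ⟨⟨s, r, h1, ⟨⟨p, q, h2, x, ⟨y, rfl⟩⟩, h3⟩, z⟩, h4⟩ := c
      obtain rfl : p = s := by omega
      exact Subtype.ext (TensorCube.ext rfl (Nat.zero_add r) HEq.rfl (cast_heq _ _))))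
      (funext fun a => by rcases a with (_ | a) | _ <;> first | rfl | exact a.elim)))

/-- An independence square `(x^k_i)` in `T`; here `edge k i` is `x^k_{i+1}`. -/
@[ext]
structure IndepSquare (T : LtimesTS.{u, v}) where
  /-- the four edges -/
  edge : Fin 2 → Fin 2 → T.U.pcs.cube 1
  d_edge : ∀ k l : Fin 2, T.U.pcs.d rfl k 0 (edge l 1) = T.U.pcs.d rfl l 0 (edge k 0)
  label_edge : ∀ i : Fin 2, T.U.label (edge 0 i) = T.U.label (edge 1 i)
  rel_edge : T.rel (T.U.label (edge 0 1)) (T.U.label (edge 0 0))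

/-- The 2-truncated precubical set obtained from `T` by adding the independence squares. -/
def psiPcs (T : LtimesTS.{u, v}) : PrecubicalSet.{u} where
  cube n := match n with
    | 0 => T.U.pcs.cube 0
    | 1 => T.U.pcs.cube 1
    | 2 => IndepSquare T
    | _ + 3 => PEmpty
  d {m n} h k i x := match m, n, h, i, x with
    | 0, _, rfl, i, x => T.U.pcs.d rfl k i x
    | 1, _, rfl, i, x => x.edge k i
    | _ + 2, _, rfl, _, x => x.elim
  d_d {m n r} h h' k l i j hij hj x := match m, n, r, h, h', i, j, hij, hj, x with
    | 0, _, _, rfl, rfl, 0, 1, _, _, x => x.d_edge k l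
    | 0, _, _, rfl, rfl, 0, _ + 2, _, hj, _ => absurd hj (by omega)
    | 0, _, _, rfl, rfl, _ + 1, _, hij, hj, _ => absurd hij (by omega)
    | _ + 1, _, _, rfl, rfl, _, _, _, _, x => x.elim

/-- The HDA `Ψ(T)`. -/
def psi (T : LtimesTS.{u, v}) : HDA.{u, v} where
  pcs := T.psiPcs
  init := T.U.init
  final := T.U.final
  Label := T.U.Label
  label := T.U.label
  label_d i x := IndepSquare.label_edge x i

/-- The morphism `Ψ(f)`. -/
def psiMap {S T : LtimesTS.{u, v}} (f : S ⟶ T) : S.psi ⟶ T.psi where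
  map :=
    { app := fun n x => match n, x with
        | 0, x => f.onU.map.app 0 x
        | 1, x => f.onU.map.app 1 x
        | 2, x =>
          { edge := fun k i => f.onU.map.app 1 (x.edge k i)
            d_edge := fun k l => by rw [← f.onU.map.map_d, ← f.onU.map.map_d, x.d_edge]
            label_edge := fun i => by rw [f.onU.label_map, f.onU.label_map, x.label_edge]
            rel_edge := by
              rw [f.onU.label_map, f.onU.label_map]
              exact f.rel_map _ _ x.rel_edge }
        | _ + 3, x => x.elim
      map_d := fun {m n} h k i x => match m, n, h, i, x with
        | 0, _, rfl, i, x => f.onU.map.map_d rfl k i x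
        | 1, _, rfl, _, _ => rfl
        | _ + 2, _, rfl, _, x => x.elim }
  onLabel := f.onU.onLabel
  map_init := f.onU.map_init
  map_final := f.onU.map_final
  label_map := f.onU.label_map

/-- The functor `Ψ`, from `⋉`-transition systems to 2-truncated extensional HDAs. -/
def Psi : LtimesTS.{u, v} ⥤ HDAext₂.{u, v} where
  obj T := ⟨T.psi, T.isExtensionalTruncated.1, fun m hm => match m, hm with
    | _ + 3, _ => inferInstanceAs (IsEmpty PEmpty)⟩
  map f := ObjectProperty.homMk (psiMap f)
  map_id T := by
    apply ObjectProperty.hom_ext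
    refine HDA.Hom.ext ?_ rfl
    apply PrecubicalSet.Hom.ext
    funext n x
    match n, x with
    | 0, _ => rfl
    | 1, _ => rfl
    | 2, _ => rfl
    | _ + 3, x => exact x.elim
  map_comp f g := by
    apply ObjectProperty.hom_ext
    refine HDA.Hom.ext ?_ rfl
    apply PrecubicalSet.Hom.ext
    funext n x
    match n, x with
    | 0, _ => rfl
    | 1, _ => rfl
    | 2, _ => rfl
    | _ + 3, x => exact x.elim

/-- The HDA model functor `𝒜 = Γ₂ ∘ Ψ`. -/
def hdaModel : LtimesTS.{u, v} ⥤ HDAext.{u, v} := Psi ⋙ Gamma₂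

/-- The identification `Ψ(T)_{≤ 1} = U(T)`. -/
def skeletonPsi (T : LtimesTS.{u, v}) : T.psi.skeleton 1 ≅ T.U where
  hom :=
    { map :=
        { app := fun n x => match n, x with
            | 0, x => x.1
            | 1, x => x.1
            | _ + 2, x => absurd x.2 (by omega)
          map_d := fun {m n} h k i x => match m, n, h, i, x with
            | 0, _, rfl, i, x => rfl
            | _ + 1, _, rfl, _, x => absurd x.2 (by omega) }
      onLabel := fun a => a
      map_init := rfl
      map_final := fun _ hx => hx
      label_map := fun _ => rfl }
  inv :=
    { map :=
        { app := fun n x => match n, x with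
            | 0, x => ⟨x, Nat.zero_le 1⟩
            | 1, x => ⟨x, le_rfl⟩
            | n + 2, x => ((T.isExtensionalTruncated.2 (n + 2) (by omega)).elim x)
          map_d := fun {m n} h k i x => match m, n, h, i, x with
            | 0, _, rfl, i, x => rfl
            | m + 1, _, rfl, _, x => (T.isExtensionalTruncated.2 (m + 2) (by omega)).elim x }
      onLabel := fun a => a
      map_init := rfl
      map_final := fun _ hx => hx
      label_map := fun _ => rfl }
  hom_inv_id := HDA.Hom.ext (PrecubicalSet.Hom.ext (by
    funext m x
    match m, x with
    | 0, _ => rfl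
    | 1, _ => rfl
    | _ + 2, x => exact absurd x.2 (by omega))) rfl
  inv_hom_id := HDA.Hom.ext (PrecubicalSet.Hom.ext (by
    funext m x
    match m, x with
    | 0, _ => rfl
    | 1, _ => rfl
    | m + 2, x => exact (T.isExtensionalTruncated.2 (m + 2) (by omega)).elim x)) rfl

/-- The identification `𝒜(T)_{≤ 1} = U(T)`. -/
def skeletonModel (T : LtimesTS.{u, v}) : (hdaModel.obj T).obj.skeleton 1 ≅ T.U :=
  T.psi.skeletonCoskeleton ≪≫ T.skeletonPsi

/-- The identification `(𝒜(S) ⊗ 𝒜(T))_{≤ 1} = (𝒜(S)_{≤ 1} ⊗ 𝒜(T)_{≤ 1})_{≤ 1} =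
(U(S) ⊗ U(T))_{≤ 1} = U(S ⫴ T)`. -/
def skeletonModelTensor (S T : LtimesTS.{u, v}) :
    (hdaModel.obj S ⊗ hdaModel.obj T).obj.skeleton 1 ≅ (S ⊗ T).U :=
  (HDA.skeletonTensorLeft 1 _ _).symm ≪≫ (HDA.skeletonTensorRight 1 _ _).symm ≪≫
    HDA.skeletonIso 1 (MonoidalCategory.tensorIso S.skeletonModel T.skeletonModel)

/-- A morphism `𝒜(S) ⊗ 𝒜(T) → 𝒜(S ⫴ T)` restricts to the identity on `U(S ⫴ T)`. -/
def RestrictsToId {S T : LtimesTS.{u, v}}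
    (g : hdaModel.obj S ⊗ hdaModel.obj T ⟶ hdaModel.obj (S ⊗ T)) : Prop :=
  HDA.skeletonMap 1 g.hom ≫ (S ⊗ T).skeletonModel.hom = (skeletonModelTensor S T).hom

end LtimesTS

/-! A cube of `𝒜(T)` is the same thing as a labelled cube-shaped diagram of states: states `v(a)`
for `a ∈ {0,1}^m` and labels `l_1, …, l_m` such that, in each direction `i`, edges labelled `l_i`
join `v(a)` with `a_i = 0` to `v(a)` with `a_i = 1`, and `l_i ⋉ l_j` for `i < j`. Such data is a
cube because of the coskeleton: a cube is a morphism from a 2-skeleton, so it is given by its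
vertices, edges and independence squares (`IsCube.exists_model_cube`, `isCube_of_model_cube`).
Vertices and labels suffice to determine it, because `T` is extensional and an independence square
is determined by its edges (`model_cube_ext`).

Hence, for every HDA `B`, a morphism `B ⟶ 𝒜(T)` is determined by its effect on vertices and labels
(`model_hom_ext`), and one exists as soon as edges go to edges and the two labels of each square
become related (`exists_model_hom`). For `B = 𝒜(S) ⊗ 𝒜(T)` and the identity on 1-skeleta, the
squares of mixed type satisfy the condition because every label of `S` is related to every label of
`T`. This gives `μ`, and its uniqueness, naturality and coherence are comparisons of vertices and
labels.

Bijectivity of `μ` rests on the asymmetry of the relation: no label of `T` is related to a label of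
`S`. So the directions of a cube of `𝒜(S ⫴ T)` are first `p` directions of `S`, then `q` directions
of `T` (`exists_label_split`). Along an edge of `S` the `T`-component of the state is constant, and
vice versa; thus `v(b, c) = (v_S(b), v_T(c))`, where `v_S` and `v_T` are cubes of `𝒜(S)` and `𝒜(T)`.
This gives surjectivity; for injectivity, `p` and both components can be read off from the labels
and the vertices. -/

namespace PrecubicalSet

/-! ### Vertices, edges and squares of a cube -/

variable {P Q : PrecubicalSet.{u}}

/-- The recursions below strip coordinates near the front of a cube, so the precubical identity is
needed only with lower index 0 (here) or 1 (next lemma). -/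
theorem d_zero_d_succ {m : ℕ} (k l : Fin 2) (i : Fin (m + 1)) (x : P.cube (m + 2)) :
    P.d rfl k 0 (P.d rfl l i.succ x) = P.d rfl l i (P.d rfl k 0 x) :=
  P.d_d rfl rfl k l 0 (i + 1) (by omega) (by omega) x

theorem d_succ_d_succ_succ {m : ℕ} (k l : Fin 2) (i : Fin (m + 1)) (x : P.cube (m + 3)) :
    P.d rfl k (0 : Fin (m + 1)).succ (P.d rfl l i.succ.succ x) =
      P.d rfl l i.succ (P.d rfl k (0 : Fin (m + 2)).succ x) :=
  P.d_d rfl rfl k l 1 (i + 2) (by omega) (by omega) x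

/-- The vertex of the cube `x` with the coordinates `a`. -/
def vertexAt : ∀ {m : ℕ}, P.cube m → (Fin m → Fin 2) → P.cube 0
  | 0, x, _ => x
  | _ + 1, x, a => vertexAt (P.d rfl (a 0) 0 x) (Fin.tail a)

/-- The edge of the cube `x` in the first direction whose other coordinates are `a`. -/
def firstEdge : ∀ {m : ℕ}, P.cube (m + 1) → (Fin m → Fin 2) → P.cube 1
  | 0, x, _ => x
  | m + 1, x, a => firstEdge (P.d rfl (a 0) (0 : Fin (m + 1)).succ x) (Fin.tail a)

/-- The square of the cube `x` in the first two directions whose other coordinates are `a`. -/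
def firstSquare : ∀ {m : ℕ}, P.cube (m + 2) → (Fin m → Fin 2) → P.cube 2
  | 0, x, _ => x
  | m + 1, x, a => firstSquare (P.d rfl (a 0) (0 : Fin (m + 1)).succ.succ x) (Fin.tail a)

theorem vertexAt_succ {m : ℕ} (x : P.cube (m + 1)) (a : Fin (m + 1) → Fin 2) :
    vertexAt x a = vertexAt (P.d rfl (a 0) 0 x) (Fin.tail a) := rfl

theorem firstEdge_succ {m : ℕ} (x : P.cube (m + 2)) (a : Fin (m + 1) → Fin 2) :
    firstEdge x a = firstEdge (P.d rfl (a 0) (0 : Fin (m + 1)).succ x) (Fin.tail a) := rfl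

theorem firstSquare_succ {m : ℕ} (x : P.cube (m + 3)) (a : Fin (m + 1) → Fin 2) :
    firstSquare x a = firstSquare (P.d rfl (a 0) (0 : Fin (m + 1)).succ.succ x) (Fin.tail a) :=
  rfl

theorem Hom.app_vertexAt (f : Hom P Q) : ∀ {m : ℕ} (x : P.cube m) (a : Fin m → Fin 2),
    f.app 0 (vertexAt x a) = vertexAt (f.app m x) a
  | 0, _, _ => rfl
  | m + 1, x, a => by rw [vertexAt_succ, f.app_vertexAt, f.map_d]; rfl

theorem Hom.app_firstEdge (f : Hom P Q) : ∀ {m : ℕ} (x : P.cube (m + 1)) (a : Fin m → Fin 2),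
    f.app 1 (firstEdge x a) = firstEdge (f.app (m + 1) x) a
  | 0, _, _ => rfl
  | m + 1, x, a => by rw [firstEdge_succ, f.app_firstEdge, f.map_d]; rfl

theorem d_firstEdge (k : Fin 2) : ∀ {m : ℕ} (x : P.cube (m + 1)) (a : Fin m → Fin 2),
    P.d rfl k 0 (firstEdge x a) = vertexAt x (Fin.cons k a)
  | 0, _, _ => rfl
  | m + 1, x, a => by
    rw [firstEdge_succ, d_firstEdge, vertexAt_succ, vertexAt_succ, vertexAt_succ]
    simp only [Fin.cons_zero, Fin.tail_cons]
    rw [d_zero_d_succ]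

/-- A face operator removes its direction: face 0 of a square is an edge in the second direction,
and face 1 is an edge in the first. This explains the crossed indices wherever labels of squares
occur. -/
theorem d_zero_firstSquare (k : Fin 2) : ∀ {m : ℕ} (x : P.cube (m + 2)) (a : Fin m → Fin 2),
    P.d rfl k 0 (firstSquare x a) = firstEdge (P.d rfl k 0 x) a
  | 0, _, _ => rfl
  | m + 1, x, a => by
    rw [firstSquare_succ, d_zero_firstSquare, firstEdge_succ, d_zero_d_succ]

theorem d_one_firstSquare (k : Fin 2) : ∀ {m : ℕ} (x : P.cube (m + 2)) (a : Fin m → Fin 2),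
    P.d rfl k 1 (firstSquare x a) = firstEdge (P.d rfl k (0 : Fin (m + 1)).succ x) a
  | 0, _, _ => rfl
  | m + 1, x, a => by
    rw [firstSquare_succ, d_one_firstSquare, firstEdge_succ, d_succ_d_succ_succ]

theorem insertNth_succ_zero {m : ℕ} (i : Fin (m + 1)) (k : Fin 2) (a : Fin (m + 1) → Fin 2) :
    (i.succ.insertNth k a : Fin (m + 2) → Fin 2) 0 = a 0 := by
  have h := Fin.insertNth_apply_succAbove (α := fun _ => Fin 2) i.succ k a 0
  rwa [Fin.succ_succAbove_zero] at h

theorem tail_insertNth_succ {m : ℕ} (i : Fin (m + 1)) (k : Fin 2) (a : Fin (m + 1) → Fin 2) :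
    Fin.tail (i.succ.insertNth k a : Fin (m + 2) → Fin 2) = i.insertNth k (Fin.tail a) := by
  symm
  rw [Fin.insertNth_eq_iff]
  refine ⟨(Fin.insertNth_apply_same (α := fun _ => Fin 2) i.succ k a).symm, ?_⟩
  funext j
  have h := Fin.insertNth_apply_succAbove (α := fun _ => Fin 2) i.succ k a j.succ
  rw [Fin.succ_succAbove_succ] at h
  exact h.symm

/-- Passing to a face freezes one coordinate. Together with `dirLabel_d`, this lets the vertices and
labels of a cube control those of its faces, which makes induction on the degree possible. -/
theorem vertexAt_d (k : Fin 2) : ∀ {m : ℕ} (i : Fin (m + 1)) (x : P.cube (m + 1))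
    (a : Fin m → Fin 2), vertexAt (P.d rfl k i x) a = vertexAt x (i.insertNth k a)
  | m, i, x, a => by
    induction i using Fin.cases with
    | zero => rw [Fin.insertNth_zero']; rfl
    | succ i =>
      cases m with
      | zero => exact i.elim0
      | succ m =>
        rw [vertexAt_succ, vertexAt_succ, d_zero_d_succ, vertexAt_d, insertNth_succ_zero,
          tail_insertNth_succ]

theorem firstEdge_d (k : Fin 2) : ∀ {m : ℕ} (i : Fin (m + 1)) (x : P.cube (m + 2))
    (a : Fin m → Fin 2), firstEdge (P.d rfl k i.succ x) a = firstEdge x (i.insertNth k a)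
  | m, i, x, a => by
    induction i using Fin.cases with
    | zero => rw [Fin.insertNth_zero']; rfl
    | succ i =>
      cases m with
      | zero => exact i.elim0
      | succ m =>
        rw [firstEdge_succ, firstEdge_succ, d_succ_d_succ_succ, firstEdge_d, insertNth_succ_zero,
          tail_insertNth_succ]

end PrecubicalSet

/-! ### Labels of the directions of a cube -/

namespace HDA

variable {A B : HDA.{u, v}}

/-- Edges that differ in one remaining coordinate are opposite sides of a square, hence have the
same label; the coordinates are changed one at a time. This makes `dirLabel` independent of its base
point. -/
theorem label_firstEdge_eq : ∀ {m : ℕ} (x : A.pcs.cube (m + 1)) (a b : Fin m → Fin 2),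
    A.label (firstEdge x a) = A.label (firstEdge x b)
  | 0, _, _, _ => rfl
  | m + 1, x, a, b => by
    have key : ∀ k : Fin 2, A.label (firstEdge (A.pcs.d rfl k (0 : Fin (m + 1)).succ x)
        (Fin.tail a)) = A.label (firstEdge (A.pcs.d rfl 0 (0 : Fin (m + 1)).succ x)
        (Fin.tail a)) := by
      intro k
      obtain rfl | rfl : k = 0 ∨ k = 1 := by omega
      · rfl
      · rw [← d_one_firstSquare, ← d_one_firstSquare, A.label_d]
    rw [firstEdge_succ, firstEdge_succ, key, ← key (b 0)]
    exact label_firstEdge_eq _ _ _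

/-- The label of the edges of the cube `x` in a given direction. -/
def dirLabel (A : HDA.{u, v}) : ∀ {m : ℕ}, A.pcs.cube m → Fin m → A.Label
  | 0, _ => Fin.elim0
  | _ + 1, x => Fin.cons (A.label (firstEdge x 0)) (A.dirLabel (A.pcs.d rfl 0 0 x))

theorem dirLabel_zero {m : ℕ} (x : A.pcs.cube (m + 1)) (a : Fin m → Fin 2) :
    A.dirLabel x 0 = A.label (firstEdge x a) :=
  label_firstEdge_eq x 0 a

theorem dirLabel_d_zero : ∀ {m : ℕ} (x : A.pcs.cube (m + 1)) (k : Fin 2),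
    A.dirLabel (A.pcs.d rfl k 0 x) = A.dirLabel (A.pcs.d rfl 0 0 x)
  | 0, _, _ => funext fun i => i.elim0
  | m + 1, x, k => by
    funext i
    induction i using Fin.cases with
    | zero =>
      rw [dirLabel_zero _ 0, dirLabel_zero _ 0, ← d_zero_firstSquare, ← d_zero_firstSquare]
      obtain rfl | rfl : k = 0 ∨ k = 1 := by omega
      · rfl
      · rw [A.label_d]
    | succ i =>
      change A.dirLabel (A.pcs.d rfl 0 0 (A.pcs.d rfl k 0 x)) i =
        A.dirLabel (A.pcs.d rfl 0 0 (A.pcs.d rfl 0 0 x)) i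
      -- Exchanging the two faces makes the one that depends on `k` the outer front face of a
      -- smaller cube, where induction applies.
      rw [← d_zero_d_succ, dirLabel_d_zero, d_zero_d_succ, dirLabel_d_zero]

theorem dirLabel_succ {m : ℕ} (x : A.pcs.cube (m + 1)) (k : Fin 2) (i : Fin m) :
    A.dirLabel x i.succ = A.dirLabel (A.pcs.d rfl k 0 x) i := by
  rw [dirLabel_d_zero]
  rfl

theorem dirLabel_d (k : Fin 2) : ∀ {m : ℕ} (i : Fin (m + 1)) (x : A.pcs.cube (m + 1))
    (j : Fin m), A.dirLabel (A.pcs.d rfl k i x) j = A.dirLabel x (i.succAbove j)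
  | m, i, x, j => by
    induction i using Fin.cases with
    | zero => rw [Fin.succAbove_zero, ← dirLabel_succ]
    | succ i =>
      cases m with
      | zero => exact i.elim0
      | succ m =>
        induction j using Fin.cases with
        | zero =>
          rw [Fin.succ_succAbove_zero, dirLabel_zero _ 0, firstEdge_d, ← dirLabel_zero]
        | succ j =>
          rw [Fin.succ_succAbove_succ, dirLabel_succ _ 0, d_zero_d_succ, dirLabel_d,
            ← dirLabel_succ]

theorem dirLabel_map (f : A ⟶ B) : ∀ {m : ℕ} (x : A.pcs.cube m) (i : Fin m),
    B.dirLabel (f.map.app m x) i = f.onLabel (A.dirLabel x i)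
  | 0, _, i => i.elim0
  | m + 1, x, i => by
    induction i using Fin.cases with
    | zero => rw [dirLabel_zero _ 0, dirLabel_zero _ 0, ← f.map.app_firstEdge, f.label_map]
    | succ i => rw [dirLabel_succ _ 0, dirLabel_succ _ 0, ← f.map.map_d, dirLabel_map]

/-- The edges of a cube join its vertices. -/
theorem exists_edge_of_cube : ∀ {m : ℕ} (x : A.pcs.cube m) (i : Fin m) (a : Fin m → Fin 2),
    ∃ e : A.pcs.cube 1, A.label e = A.dirLabel x i ∧
      ∀ k : Fin 2, A.pcs.d rfl k 0 e = vertexAt x (Function.update a i k)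
  | 0, _, i, _ => i.elim0
  | m + 1, x, i, a => by
    induction i using Fin.cases with
    | zero =>
      refine ⟨firstEdge x (Fin.tail a), (dirLabel_zero x _).symm, fun k => ?_⟩
      rw [d_firstEdge]
      congr 1
      conv_rhs => rw [← Fin.cons_self_tail a, Fin.update_cons_zero]
    | succ i =>
      obtain ⟨e, h1, h2⟩ := exists_edge_of_cube (A.pcs.d rfl (a 0) 0 x) i (Fin.tail a)
      refine ⟨e, by rw [h1, ← dirLabel_succ], fun k => ?_⟩
      rw [h2, vertexAt_succ]
      have h3 : Function.update a i.succ k = Fin.cons (a 0) (Function.update (Fin.tail a) i k) := by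
        conv_lhs => rw [← Fin.cons_self_tail a, ← Fin.cons_update]
      rw [h3, Fin.cons_zero, Fin.tail_cons]

/-- A cube has a square in any two of its directions. -/
theorem exists_square_of_cube : ∀ {m : ℕ} (x : A.pcs.cube m) (i j : Fin m), i < j →
    ∃ c : A.pcs.cube 2, A.label (A.pcs.d rfl 0 1 c) = A.dirLabel x i ∧
      A.label (A.pcs.d rfl 0 0 c) = A.dirLabel x j
  | 0, _, i, _, _ => i.elim0
  | m + 1, x, i, j, hij => by
    induction j using Fin.cases with
    | zero => exact absurd hij (Fin.not_lt_zero i)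
    | succ j =>
      induction i using Fin.cases with
      | succ i =>
        obtain ⟨c, h1, h2⟩ := exists_square_of_cube (A.pcs.d rfl 0 0 x) i j
          (Fin.succ_lt_succ_iff.1 hij)
        exact ⟨c, by rw [h1, ← dirLabel_succ], by rw [h2, ← dirLabel_succ]⟩
      | zero =>
        cases m with
        | zero => exact j.elim0
        | succ m =>
          induction j using Fin.cases with
          | zero =>
            refine ⟨firstSquare x 0, ?_, ?_⟩
            · rw [d_one_firstSquare, firstEdge_d, ← dirLabel_zero]
            · rw [d_zero_firstSquare, ← dirLabel_zero, ← dirLabel_succ]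
          | succ j =>
            -- The second direction is neither of the two required. A face in that direction keeps
            -- direction 0 and lowers the other index by one.
            obtain ⟨c, h1, h2⟩ := exists_square_of_cube
              (A.pcs.d rfl 0 (0 : Fin (m + 1)).succ x) 0 j.succ (Fin.succ_pos j)
            refine ⟨c, ?_, ?_⟩
            · rw [h1, dirLabel_d, Fin.succ_succAbove_zero]
            · rw [h2, dirLabel_d, Fin.succ_succAbove_succ, Fin.succAbove_zero]

end HDA

/-! ### Coordinates and directions in the standard cubes -/

namespace PrecubicalSet

/-- The coordinates of a vertex of the precubical `m`-cube. -/
def vertexCoord : ∀ {m n : ℕ}, n = 0 → (stdCube.{u} m).cube n → Fin m → Fin 2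
  | 0, _, _, _ => Fin.elim0
  | m + 1, _, hn, c => Fin.cons
      (match c with
        | ⟨0, _, _, k, _⟩ => ULift.down k
        | ⟨_ + 1, _, h, _, _⟩ => absurd h (by omega))
      (vertexCoord (by have := TensorCube.deg c; omega) (TensorCube.snd c))

/-- The direction of an edge of the precubical `m`-cube. -/
def edgeDir : ∀ {m : ℕ}, (stdCube.{u} m).cube 1 → Fin m
  | 0, c => absurd c.2 one_ne_zero
  | m + 1, c => match c with
    | ⟨0, q, h, _, y⟩ => Fin.succ (edgeDir (cast (congrArg (stdCube m).cube (by omega)) y))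
    | ⟨_ + 1, _, _, _, _⟩ => 0

theorem interval_cube_cases {p : ℕ} (x : interval.{u}.cube p) : p = 0 ∨ p = 1 :=
  match p, x with
  | 0, _ => Or.inl rfl
  | 1, _ => Or.inr rfl
  | _ + 2, x => x.elim

/-- The ends of an edge differ only in the coordinate of its direction. Each edge of the standard
cube is thus encoded by its direction and its initial vertex. -/
theorem vertexCoord_d (k : Fin 2) : ∀ {m : ℕ} (e : (stdCube.{u} m).cube 1),
    vertexCoord rfl ((stdCube m).d rfl k 0 e) =
      Function.update (vertexCoord rfl ((stdCube m).d rfl 0 0 e)) (edgeDir e) k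
  | 0, c => absurd c.2 one_ne_zero
  | m + 1, ⟨p, q, h, x, y⟩ => by
    rcases interval_cube_cases x with rfl | rfl
    · obtain rfl : q = 1 := by omega
      have h1 : ∀ l : Fin 2, (stdCube.{u} (m + 1)).d rfl l 0 ⟨0, 1, h, x, y⟩ =
        (⟨0, 0, rfl, x, (stdCube m).d rfl l 0 y⟩ : TensorCube interval (stdCube m) 0) :=
        fun l => rfl
      rw [h1, h1]
      change Fin.cons (ULift.down x) (vertexCoord rfl ((stdCube m).d rfl k 0 y)) = Function.update
        (Fin.cons (ULift.down x) (vertexCoord rfl ((stdCube m).d rfl 0 0 y)) : Fin (m + 1) → Fin 2)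
        (edgeDir y).succ k
      rw [vertexCoord_d, Fin.cons_update]
    · obtain rfl : q = 0 := by omega
      exact (Fin.update_cons_zero (α := fun _ => Fin 2) 0 (vertexCoord rfl y) k).symm

theorem edgeDir_d : ∀ {m : ℕ} (c : (stdCube.{u} m).cube 2) (i : Fin 2),
    edgeDir ((stdCube m).d rfl 0 i c) = edgeDir ((stdCube m).d rfl 1 i c)
  | 0, c, _ => absurd c.2 two_ne_zero
  | m + 1, ⟨p, q, h, x, y⟩, i => by
    rcases interval_cube_cases x with rfl | rfl
    · obtain rfl : q = 2 := by omega
      obtain rfl | rfl : i = 0 ∨ i = 1 := by omega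
      · exact congrArg Fin.succ (edgeDir_d y 0)
      · exact congrArg Fin.succ (edgeDir_d y 1)
    · obtain rfl : q = 1 := by omega
      obtain rfl | rfl : i = 0 ∨ i = 1 := by omega
      · rfl
      · rfl

/-- Directions in a square come in increasing order. A relation between labels in increasing
directions is therefore enough to turn all squares into independence squares. -/
theorem edgeDir_lt : ∀ {m : ℕ} (c : (stdCube.{u} m).cube 2) ,
    edgeDir ((stdCube m).d rfl 0 1 c) < edgeDir ((stdCube m).d rfl 0 0 c)
  | 0, c => absurd c.2 two_ne_zero
  | m + 1, ⟨p, q, h, x, y⟩ => by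
    rcases interval_cube_cases x with rfl | rfl
    · obtain rfl : q = 2 := by omega
      exact Fin.succ_lt_succ_iff.2 (edgeDir_lt y)
    · obtain rfl : q = 1 := by omega
      exact Fin.succ_pos (edgeDir y)

/-- The definition of `coface` matches on `m` as well as on the index, so it does not unfold for a
variable `m`, even at index 0. -/
theorem coface_zero (k : Fin 2) (m : ℕ) (h : 0 < m + 1) :
    coface.{u} k m 0 h = insertEnd k (stdCube m) := by
  cases m <;> rfl

/-- The vertex of the precubical `m`-cube with given coordinates. -/
def stdVertex : ∀ {m : ℕ}, (Fin m → Fin 2) → (stdCube.{u} m).cube 0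
  | 0, _ => (⟨PUnit.unit, rfl⟩ : { _x : PUnit.{u + 1} // 0 = 0 })
  | m + 1, a => (⟨0, 0, rfl, interval.vertex (a 0), stdVertex (Fin.tail a)⟩ :
      TensorCube interval (stdCube m) 0)

theorem vertexCoord_stdVertex : ∀ {m : ℕ} (a : Fin m → Fin 2),
    vertexCoord rfl (stdVertex.{u} a) = a
  | 0, _ => funext fun i => i.elim0
  | m + 1, a => by
    change Fin.cons (a 0) (vertexCoord rfl (stdVertex.{u} (Fin.tail a))) = a
    rw [vertexCoord_stdVertex, Fin.cons_self_tail]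

/-- Faces in the coskeleton are precompositions with cofaces, so taking front faces repeatedly
amounts to evaluating the morphism at a vertex of the standard cube. -/
theorem coskeletonEval_vertexAt {n : ℕ} {P : PrecubicalSet.{u}} : ∀ {m : ℕ}
    (f : Hom ((stdCube m).skeleton n) P) (a : Fin m → Fin 2),
    coskeletonEval (Nat.zero_le n) (vertexAt (P := P.coskeleton n) f a) =
      f.app 0 ⟨stdVertex a, Nat.zero_le n⟩
  | 0, _, _ => rfl
  | m + 1, f, a =>
    (coskeletonEval_vertexAt (((coface (a 0) m 0 (Nat.succ_pos m)).skeleton n).comp f)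
      (Fin.tail a)).trans
    (congrArg (fun g => f.app 0 ⟨Hom.app g 0 (stdVertex (Fin.tail a)), Nat.zero_le n⟩)
      (coface_zero (a 0) m (Nat.succ_pos m)))

theorem coskeletonEval_firstEdge {n : ℕ} (hn : 1 ≤ n) {P : PrecubicalSet.{u}} : ∀ {m : ℕ}
    (f : Hom ((stdCube (m + 1)).skeleton n) P) (a : Fin m → Fin 2),
    coskeletonEval hn (firstEdge (P := P.coskeleton n) f a) =
      f.app 1 ⟨(⟨1, 0, rfl, interval.edge, stdVertex a⟩ : TensorCube interval (stdCube m) 1), hn⟩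
  | 0, _, _ => rfl
  | m + 1, f, a =>
    (coskeletonEval_firstEdge hn
      (((coface (a 0) (m + 1) 1 (by omega)).skeleton n).comp f) (Fin.tail a)).trans
    (congrArg (fun g => f.app 1 ⟨((Hom.id interval).tensor g).app 1
      (⟨1, 0, rfl, interval.edge, stdVertex (Fin.tail a)⟩ : TensorCube interval (stdCube m) 1), hn⟩)
      (coface_zero (a 0) m (Nat.succ_pos m)))

/-- Every cube of degree `< m` of the precubical `m`-cube lies on a face. -/
theorem exists_coface_eq : ∀ {m n : ℕ} (c : (stdCube.{u} (m + 1)).cube n), n < m + 1 →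
    ∃ (k : Fin 2) (i : Fin (m + 1)) (c' : (stdCube m).cube n), (coface k m i i.2).app n c' = c
  | m, n, ⟨p, q, h, x, y⟩, hn => by
    rcases interval_cube_cases x with rfl | rfl
    · obtain rfl : q = n := by omega
      -- If the first factor is a vertex, the cube lies on a front face; otherwise the second factor
      -- has smaller degree than its ambient cube, and induction applies to it.
      exact ⟨ULift.down x, 0, y, congrArg (fun g => Hom.app g q y) (coface_zero _ m _)⟩
    · cases m with
      | zero => omega
      | succ m =>
        obtain ⟨k, i, c', rfl⟩ := exists_coface_eq y (by omega)
        exact ⟨k, i.succ, (⟨1, q, h, x, c'⟩ : TensorCube interval (stdCube m) n), rfl⟩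

end PrecubicalSet

/-! ### Cubes of `𝒜(T)` and morphisms to `𝒜(T)` in terms of states and labels -/

namespace LtimesTS

variable {S T : LtimesTS.{u, v}}

/-- The HDA `𝒜(T)`. -/
abbrev model (T : LtimesTS.{u, v}) : HDA.{u, v} := T.psi.coskeleton

/-- The state of `T` corresponding to a vertex of `𝒜(T)`. -/
abbrev state (x : T.model.pcs.cube 0) : T.U.pcs.cube 0 :=
  coskeletonEval (P := T.psiPcs) (Nat.zero_le 2) x

theorem state_injective : Function.Injective (state (T := T)) :=
  coskeletonEval_zero_injective

/-- A cube of `𝒜(T)` is determined by its vertices and labels. -/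
theorem model_cube_ext : ∀ {m : ℕ} (x y : T.model.pcs.cube m),
    (∀ a, vertexAt x a = vertexAt y a) → T.model.dirLabel x = T.model.dirLabel y → x = y
  | 0, x, y, hv, _ => hv 0
  | 1, x, y, hv, hl => by
    refine T.psi.coskeleton_isExtensional T.isExtensionalTruncated.1 x y ?_ ?_ ?_
    · exact congrFun hl 0
    · exact hv (fun _ => 0)
    · exact hv (fun _ => 1)
  | m + 2, x, y, hv, hl => by
    -- Away from the top degree, the two morphisms are tested on faces, which agree by induction.
    have key : ∀ (n : ℕ) (hn : n ≤ 2) (c : (stdCube (m + 2)).cube n), n < m + 2 →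
        PrecubicalSet.Hom.app x n ⟨c, hn⟩ = PrecubicalSet.Hom.app y n ⟨c, hn⟩ := by
      intro n hn c hc
      obtain ⟨k, i, c', rfl⟩ := exists_coface_eq c hc
      have h := model_cube_ext (T.model.pcs.d rfl k i x) (T.model.pcs.d rfl k i y)
        (fun a => by rw [vertexAt_d, vertexAt_d, hv])
        (funext fun j => by rw [HDA.dirLabel_d, HDA.dirLabel_d, hl])
      exact congrArg (fun f : T.model.pcs.cube (m + 1) => PrecubicalSet.Hom.app f n ⟨c', hn⟩) h
    apply PrecubicalSet.Hom.ext
    funext n c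
    obtain ⟨c, hn⟩ := c
    match n, c, hn with
    | 0, c, hn => exact key 0 hn c (by omega)
    | 1, c, hn => exact key 1 hn c (by omega)
    | 2, c, hn =>
      -- For `m = 0` this may be the top cube, which lies on no face; an independence square is
      -- nevertheless determined by its edges.
      refine IndepSquare.ext (funext fun k => funext fun i => ?_)
      exact (PrecubicalSet.Hom.map_d x (m := 1) rfl k i ⟨c, hn⟩).symm.trans
        ((key 1 one_le_two ((stdCube (m + 2)).d rfl k i c) (by omega)).trans
          (PrecubicalSet.Hom.map_d y (m := 1) rfl k i ⟨c, hn⟩))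

/-- A cube in `T`, given by its vertices and labels. -/
structure IsCube (T : LtimesTS.{u, v}) {m : ℕ} (v : (Fin m → Fin 2) → T.U.pcs.cube 0)
    (l : Fin m → T.U.Label) : Prop where
  exists_edge : ∀ (i : Fin m) (a : Fin m → Fin 2), ∃ e : T.U.pcs.cube 1, T.U.label e = l i ∧
    ∀ k : Fin 2, T.U.pcs.d rfl k 0 e = v (Function.update a i k)
  rel : ∀ i j : Fin m, i < j → T.rel (l i) (l j)

theorem dirLabel_eq_of_label_edge : ∀ {m : ℕ} (f : PrecubicalSet.Hom ((stdCube m).skeleton 2) T.psiPcs)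
    (l : Fin m → T.U.Label)
    (_ : ∀ e : (stdCube m).cube 1, T.U.label (f.app 1 ⟨e, one_le_two⟩) = l (edgeDir e)),
    T.model.dirLabel (m := m) f = l
  | 0, _, _, _ => funext fun i => i.elim0
  | m + 1, f, l, h => by
    funext i
    induction i using Fin.cases with
    | zero =>
      exact (congrArg T.psi.label (coskeletonEval_firstEdge one_le_two f 0)).trans (h _)
    | succ i =>
      exact congrFun (dirLabel_eq_of_label_edge
        (((coface 0 m 0 (Nat.succ_pos m)).skeleton 2).comp f) (Fin.tail l)
        (fun e => (h ((coface 0 m 0 (Nat.succ_pos m)).app 1 e)).trans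
          (congrArg (fun g => l (edgeDir (PrecubicalSet.Hom.app g 1 e)))
            (coface_zero 0 m (Nat.succ_pos m))))) i

/-- Once an edge of `T` is chosen for each edge of the standard cube, the squares are forced, and
they are independence squares by `rel`. Above degree 2 nothing remains to be specified, since a cube
of the coskeleton is a morphism from the 2-skeleton. -/
theorem IsCube.exists_model_cube {m : ℕ} {v : (Fin m → Fin 2) → T.U.pcs.cube 0}
    {l : Fin m → T.U.Label} (h : T.IsCube v l) :
    ∃ x : T.model.pcs.cube m, (∀ a, state (vertexAt x a) = v a) ∧ T.model.dirLabel x = l := by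
  choose E hE1 hE2 using h.exists_edge
  -- `E i a` may depend on the irrelevant coordinate `a i`; evaluation at the initial vertex fixes
  -- one choice for each edge.
  let F (e : (stdCube.{u} m).cube 1) : T.U.pcs.cube 1 :=
    E (edgeDir e) (vertexCoord rfl ((stdCube m).d rfl 0 0 e))
  have hF (k : Fin 2) (e : (stdCube.{u} m).cube 1) :
      T.U.pcs.d rfl k 0 (F e) = v (vertexCoord rfl ((stdCube m).d rfl k 0 e)) := by
    rw [hE2, vertexCoord_d k]
  let f : PrecubicalSet.Hom ((stdCube.{u} m).skeleton 2) T.psiPcs :=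
    { app := fun n c => match n, c with
        | 0, c => v (vertexCoord rfl c.1)
        | 1, c => F c.1
        | 2, c =>
          { edge := fun k i => F ((stdCube m).d rfl k i c.1)
            d_edge := fun k j => by
              rw [hF, hF]
              exact congrArg (fun c => v (vertexCoord rfl c)) (d_zero_d_succ (m := 0) k j 0 c.1)
            label_edge := fun i => by rw [hE1, hE1, edgeDir_d]
            rel_edge := by
              rw [hE1, hE1]
              exact h.rel _ _ (edgeDir_lt c.1) }
        | _ + 3, c => absurd c.2 (by omega)
      map_d := fun {n r} h k i c => match n, r, h, i, c with
        | 0, _, rfl, 0, c => (hF k c.1).symm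
        | 1, _, rfl, _, _ => rfl
        | _ + 2, _, rfl, _, c => absurd c.2 (by omega) }
  refine ⟨f, fun a => ?_, dirLabel_eq_of_label_edge f l fun e => hE1 _ _⟩
  exact (coskeletonEval_vertexAt f a).trans (congrArg v (vertexCoord_stdVertex a))

/-- Morphisms to `𝒜(T)` are determined by the vertices and labels. -/
theorem model_hom_ext {B : HDA.{u, v}} {f g : B ⟶ T.model}
    (h0 : ∀ x, state (f.map.app 0 x) = state (g.map.app 0 x)) (hl : f.onLabel = g.onLabel) :
    f = g := by
  refine HDA.Hom.ext (PrecubicalSet.Hom.ext ?_) hl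
  funext m x
  refine model_cube_ext _ _ (fun a => ?_) (funext fun i => ?_)
  · rw [← PrecubicalSet.Hom.app_vertexAt, ← PrecubicalSet.Hom.app_vertexAt]
    exact state_injective (h0 _)
  · rw [HDA.dirLabel_map, HDA.dirLabel_map, hl]

/-- Being a cube in `T` is a condition on edges and on pairs of directions. A cube of `B` contains
an edge or a square realizing each of them, so conditions in degrees 1 and 2 control all degrees. -/
theorem isCube_of_cube {B : HDA.{u, v}} (f₀ : B.pcs.cube 0 → T.U.pcs.cube 0)
    (σ : B.Label → T.U.Label)
    (hedge : ∀ e : B.pcs.cube 1, ∃ e' : T.U.pcs.cube 1, T.U.label e' = σ (B.label e) ∧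
      ∀ k : Fin 2, T.U.pcs.d rfl k 0 e' = f₀ (B.pcs.d rfl k 0 e))
    (hrel : ∀ c : B.pcs.cube 2,
      T.rel (σ (B.label (B.pcs.d rfl 0 1 c))) (σ (B.label (B.pcs.d rfl 0 0 c))))
    {m : ℕ} (x : B.pcs.cube m) :
    T.IsCube (fun a => f₀ (vertexAt x a)) (fun i => σ (B.dirLabel x i)) where
  exists_edge i a := by
    obtain ⟨e, h1, h2⟩ := HDA.exists_edge_of_cube x i a
    obtain ⟨e', h3, h4⟩ := hedge e
    exact ⟨e', by rw [h3, h1], fun k => by rw [h4, h2]⟩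
  rel i j hij := by
    obtain ⟨c, h1, h2⟩ := HDA.exists_square_of_cube x i j hij
    rw [← h1, ← h2]
    exact hrel c

/-- The converse of `IsCube.exists_model_cube`: a square of `𝒜(T)` evaluates to an independence
square, which supplies the relation between its labels. -/
theorem isCube_of_model_cube {m : ℕ} (x : T.model.pcs.cube m) :
    T.IsCube (fun a => state (vertexAt x a)) (T.model.dirLabel x) :=
  isCube_of_cube state id
    (fun e => ⟨coskeletonEval (P := T.psiPcs) one_le_two e, rfl, fun k =>
      (d_coskeletonEval (P := T.psiPcs) rfl one_le_two k 0 e).symm⟩)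
    (fun c => by
      have h := IndepSquare.rel_edge (coskeletonEval (P := T.psiPcs) le_rfl c)
      have h' : ∀ i : Fin 2, coskeletonEval (P := T.psiPcs) one_le_two (T.model.pcs.d rfl 0 i c) =
          (coskeletonEval (P := T.psiPcs) le_rfl c : IndepSquare T).edge 0 i :=
        fun i => d_coskeletonEval (P := T.psiPcs) rfl le_rfl 0 i c
      rw [← h', ← h'] at h
      exact h) x

/-- The morphism to `𝒜(T)` with given effect on vertices and labels. -/
theorem exists_model_hom {B : HDA.{u, v}} (f₀ : B.pcs.cube 0 → T.U.pcs.cube 0)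
    (σ : B.Label → T.U.Label)
    (hedge : ∀ e : B.pcs.cube 1, ∃ e' : T.U.pcs.cube 1, T.U.label e' = σ (B.label e) ∧
      ∀ k : Fin 2, T.U.pcs.d rfl k 0 e' = f₀ (B.pcs.d rfl k 0 e))
    (hrel : ∀ c : B.pcs.cube 2,
      T.rel (σ (B.label (B.pcs.d rfl 0 1 c))) (σ (B.label (B.pcs.d rfl 0 0 c))))
    (hinit : f₀ B.init = T.U.init) (hfinal : ∀ x ∈ B.final, f₀ x ∈ T.U.final) :
    ∃ g : B ⟶ T.model, (∀ x, state (g.map.app 0 x) = f₀ x) ∧ g.onLabel = σ := by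
  choose F hF1 hF2 using fun (m : ℕ) (x : B.pcs.cube m) =>
    (isCube_of_cube f₀ σ hedge hrel x).exists_model_cube
  refine ⟨
    { map :=
        { app := F
          -- The cubes are chosen independently of each other; compatibility with faces holds
          -- because both sides have the same vertices and labels.
          map_d := fun {m n} h k i x => by
            subst h
            refine model_cube_ext _ _ (fun a => state_injective ?_) (funext fun j => ?_)
            · rw [hF1, vertexAt_d, vertexAt_d, hF1]
            · refine (congrFun (hF2 m _) j).trans ?_
              rw [HDA.dirLabel_d, HDA.dirLabel_d, hF2] }
      onLabel := σ
      map_init := state_injective ((hF1 0 B.init 0).trans hinit)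
      map_final := fun x hx => ?_
      label_map := fun x => congrFun (hF2 1 x) 0 }, fun x => hF1 0 x 0, rfl⟩
  change state (F 0 x) ∈ T.U.final
  exact (hF1 0 x 0).symm ▸ hfinal x hx

end LtimesTS

/-! ### Vertices and labels in tensor products -/

namespace PrecubicalSet

variable {P Q : PrecubicalSet.{u}}

/-- Front faces act on `x` until its degree is 0, and then on `y`; so the coordinates split into two
consecutive blocks. -/
theorem vertexAt_tensor : ∀ {p q n : ℕ} (e : p + q = n) (x : P.cube p) (y : Q.cube q)
    (a : Fin n → Fin 2), vertexAt (P := P.tensor Q) (⟨p, q, e, x, y⟩ : TensorCube P Q n) a =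
      (⟨0, 0, rfl, vertexAt x (fun i => a ⟨i, by omega⟩),
        vertexAt y (fun j => a ⟨p + j, by omega⟩)⟩ : TensorCube P Q 0)
  | p + 1, q, 0, e, _, _, _ => by omega
  | p + 1, q, n + 1, e, x, y, a => by
    refine (congrArg (fun c => vertexAt (P := P.tensor Q) c (Fin.tail a))
      (TensorCube.d_left (m := n) rfl (a 0) 0 (Nat.succ_pos n) e x y rfl (Nat.succ_pos p))).trans ?_
    rw [vertexAt_tensor (by omega)]
    congr 2
    funext j
    exact congrArg a (Fin.ext (by simp only [Fin.val_succ]; omega))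
  | 0, 0, 0, e, x, y, a => rfl
  | 0, 0, n + 1, e, _, _, _ => by omega
  | 0, q + 1, 0, e, _, _, _ => by omega
  | 0, q + 1, n + 1, e, x, y, a => by
    refine (congrArg (fun c => vertexAt (P := P.tensor Q) c (Fin.tail a))
      (TensorCube.d_right (m := n) rfl (a 0) 0 (Nat.succ_pos n) e x y rfl 0 rfl)).trans ?_
    rw [vertexAt_tensor (by omega), vertexAt_succ y]
    congr 2
    funext j
    exact congrArg a (Fin.ext (by simp only [Fin.val_succ]; omega))

/-- The coordinates `b` and the vertex `w` can stay unspecified: only the label of this edge is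
used, and it does not depend on them. -/
theorem firstEdge_tensor_left : ∀ {p q n : ℕ} (e : p + 1 + q = n + 1) (x : P.cube (p + 1))
    (y : Q.cube q) (a : Fin n → Fin 2), ∃ b w,
      firstEdge (P := P.tensor Q) (⟨p + 1, q, e, x, y⟩ : TensorCube P Q (n + 1)) a =
        (⟨1, 0, rfl, firstEdge x b, w⟩ : TensorCube P Q 1)
  | p + 1, q, 0, e, _, _, _ => by omega
  | p + 1, q, n + 1, e, x, y, a => by
    obtain ⟨b, w, h⟩ := firstEdge_tensor_left (n := n) (by omega)
      (P.d rfl (a 0) (0 : Fin (p + 1)).succ x) y (Fin.tail a)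
    refine ⟨Fin.cons (a 0) b, w, Eq.trans ?_ h⟩
    exact congrArg (fun c => firstEdge (P := P.tensor Q) c (Fin.tail a))
      (TensorCube.d_left (m := n + 1) rfl (a 0) 1 (by omega) e x y rfl (by omega))
  | 0, 0, 0, e, x, y, a => ⟨0, y, rfl⟩
  | 0, 0, n + 1, e, _, _, _ => by omega
  | 0, q + 1, 0, e, _, _, _ => by omega
  | 0, q + 1, n + 1, e, x, y, a => by
    obtain ⟨b, w, h⟩ := firstEdge_tensor_left (n := n) (by omega) x (Q.d rfl (a 0) 0 y) (Fin.tail a)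
    refine ⟨b, w, Eq.trans ?_ h⟩
    exact congrArg (fun c => firstEdge (P := P.tensor Q) c (Fin.tail a))
      (TensorCube.d_right (m := n + 1) rfl (a 0) 1 (by omega) e x y rfl 0 rfl)

theorem firstEdge_tensor_right : ∀ {q n : ℕ} (e : 0 + (q + 1) = n + 1) (x : P.cube 0)
    (y : Q.cube (q + 1)) (a : Fin n → Fin 2), ∃ b,
      firstEdge (P := P.tensor Q) (⟨0, q + 1, e, x, y⟩ : TensorCube P Q (n + 1)) a =
        (⟨0, 1, rfl, x, firstEdge y b⟩ : TensorCube P Q 1)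
  | 0, 0, e, x, y, a => ⟨0, rfl⟩
  | 0, n + 1, e, _, _, _ => by omega
  | q + 1, 0, e, _, _, _ => by omega
  | q + 1, n + 1, e, x, y, a => by
    obtain ⟨b, h⟩ := firstEdge_tensor_right (n := n) (by omega) x
      (Q.d rfl (a 0) (0 : Fin (q + 1)).succ y) (Fin.tail a)
    refine ⟨Fin.cons (a 0) b, Eq.trans ?_ h⟩
    exact congrArg (fun c => firstEdge (P := P.tensor Q) c (Fin.tail a))
      (TensorCube.d_right (m := n + 1) rfl (a 0) 1 (by omega) e x y rfl 1 rfl)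

end PrecubicalSet

namespace HDA

variable {A B : HDA.{u, v}}

theorem dirLabel_tensor_left : ∀ {p q n : ℕ} (e : p + q = n) (x : A.pcs.cube p) (y : B.pcs.cube q)
    (i : ℕ) (hi : i < p),
    (A.tensor B).dirLabel (⟨p, q, e, x, y⟩ : TensorCube A.pcs B.pcs n) ⟨i, by omega⟩ =
      Sum.inl (A.dirLabel x ⟨i, hi⟩)
  | 0, _, _, _, _, _, _, hi => by omega
  | p + 1, q, 0, e, _, _, _, _ => by omega
  | p + 1, q, n + 1, e, x, y, 0, hi => by
    obtain ⟨b, w, h⟩ := firstEdge_tensor_left e x y 0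
    exact (congrArg (tensorLabel A B) h).trans
      (congrArg Sum.inl (dirLabel_zero x b).symm)
  | p + 1, q, n + 1, e, x, y, i + 1, hi => by
    refine Eq.trans ?_ (dirLabel_tensor_left (n := n) (by omega) (A.pcs.d rfl 0 0 x) y i (by omega))
    exact congrArg (fun c => (A.tensor B).dirLabel c ⟨i, by omega⟩)
      (TensorCube.d_left (m := n) rfl 0 0 (Nat.succ_pos n) e x y rfl (Nat.succ_pos p))

theorem dirLabel_tensor_right : ∀ {p q n : ℕ} (e : p + q = n) (x : A.pcs.cube p)
    (y : B.pcs.cube q) (i j : ℕ) (hi : i < n) (hj : j < q) (_ : p + j = i),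
    (A.tensor B).dirLabel (⟨p, q, e, x, y⟩ : TensorCube A.pcs B.pcs n) ⟨i, hi⟩ =
      Sum.inr (B.dirLabel y ⟨j, hj⟩)
  | _, _, 0, _, _, _, _, _, hi, _, _ => by omega
  | 0, 0, _, _, _, _, _, _, _, hj, _ => by omega
  | 0, q + 1, n + 1, e, x, y, 0, 0, hi, hj, _ => by
    obtain ⟨b, h⟩ := firstEdge_tensor_right e x y 0
    exact (congrArg (tensorLabel A B) h).trans
      (congrArg Sum.inr (dirLabel_zero y b).symm)
  | 0, _, _, _, _, _, 0, j + 1, _, _, _ => by omega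
  | 0, _, _, _, _, _, i + 1, 0, _, _, _ => by omega
  | 0, q + 1, n + 1, e, x, y, i + 1, j + 1, hi, hj, h => by
    refine Eq.trans ?_ (dirLabel_tensor_right (n := n) (by omega) x (B.pcs.d rfl 0 0 y) i j
      (by omega) (by omega) (by omega))
    exact congrArg (fun c => (A.tensor B).dirLabel c ⟨i, by omega⟩)
      (TensorCube.d_right (m := n) rfl 0 0 (Nat.succ_pos n) e x y rfl 0 rfl)
  | p + 1, _, _, _, _, _, 0, _, _, _, _ => by omega
  | p + 1, q, n + 1, e, x, y, i + 1, j, hi, hj, h => by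
    refine Eq.trans ?_ (dirLabel_tensor_right (n := n) (by omega) (A.pcs.d rfl 0 0 x) y i j
      (by omega) (by omega) (by omega))
    exact congrArg (fun c => (A.tensor B).dirLabel c ⟨i, by omega⟩)
      (TensorCube.d_left (m := n) rfl 0 0 (Nat.succ_pos n) e x y rfl (Nat.succ_pos p))

/-- A morphism of HDAs that is bijective on cubes and labels and reflects final states is an
isomorphism. -/
theorem isIso_of_bijective {A B : HDA.{u, v}} (f : A ⟶ B)
    (hf : ∀ n, Function.Bijective (f.map.app n)) (hl : Function.Bijective f.onLabel)
    (hfin : ∀ x, f.map.app 0 x ∈ B.final → x ∈ A.final) : IsIso f := by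
  choose G hG1 hG2 using fun n => Function.bijective_iff_has_inverse.1 (hf n)
  obtain ⟨s, hs1, hs2⟩ := Function.bijective_iff_has_inverse.1 hl
  refine ⟨⟨
    { map :=
        { app := G
          map_d := fun {m n} h k i x => (hf m).1 (by rw [hG2, f.map.map_d, hG2]) }
      onLabel := s
      map_init := (hf 0).1 (by rw [hG2, f.map_init])
      map_final := fun x hx => hfin _ (by rwa [hG2])
      label_map := fun x => hl.1 (by rw [← f.label_map, hG2, hs2]) }, ?_, ?_⟩⟩
  · exact HDA.Hom.ext (PrecubicalSet.Hom.ext (funext fun n => funext (hG1 n))) (funext hs1)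
  · exact HDA.Hom.ext (PrecubicalSet.Hom.ext (funext fun n => funext (hG2 n))) (funext hs2)

end HDA

/-! ### The comparison morphism `𝒜(S) ⊗ 𝒜(T) → 𝒜(S ⫴ T)` -/

namespace LtimesTS

variable {S T : LtimesTS.{u, v}}

/-- The pair of states of `S` and `T` corresponding to a vertex of `𝒜(S) ⊗ 𝒜(T)`. -/
def statePair (S T : LtimesTS.{u, v}) (c : (S.model.tensor T.model).pcs.cube 0) :
    (S.interleave T).U.pcs.cube 0 :=
  (skeletonModelTensor S T).hom.map.app 0 ⟨c, Nat.zero_le 1⟩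

/-- The identification of 1-skeleta provides everything in degrees 0 and 1, so `exists_model_hom`
leaves only the relation between the labels of a square. A square of the tensor product has bidegree
(2,0), (1,1) or (0,2). -/
theorem exists_tensorator (S T : LtimesTS.{u, v}) :
    ∃ g : S.model.tensor T.model ⟶ (S.interleave T).model,
      (∀ x, state (g.map.app 0 x) = statePair S T x) ∧ g.onLabel = fun a => a := by
  refine exists_model_hom (statePair S T) (fun a => a) (fun e => ?_) ?_
    (skeletonModelTensor S T).hom.map_init
    (fun x hx => (skeletonModelTensor S T).hom.map_final ⟨x, Nat.zero_le 1⟩ hx)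
  · refine ⟨(skeletonModelTensor S T).hom.map.app 1 ⟨e, le_rfl⟩, ?_, fun k => ?_⟩
    · refine ((skeletonModelTensor S T).hom.label_map ⟨e, le_rfl⟩).trans ?_
      change (skeletonModelTensor S T).hom.onLabel (HDA.tensorLabel S.model T.model e) =
        HDA.tensorLabel S.model T.model e
      cases HDA.tensorLabel S.model T.model e <;> rfl
    · exact ((skeletonModelTensor S T).hom.map.map_d rfl k 0 ⟨e, le_rfl⟩).symm
  · rintro ⟨p, q, e, x, y⟩
    obtain ⟨rfl, rfl⟩ | ⟨rfl, rfl⟩ | ⟨rfl, rfl⟩ :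
      (p = 2 ∧ q = 0) ∨ (p = 1 ∧ q = 1) ∨ (p = 0 ∧ q = 2) := by omega
    · exact (isCube_of_model_cube x).rel 0 1 Nat.zero_lt_one
    -- In bidegree (1,1) the label of `S` comes first, and it is related to every label of `T` by
    -- definition.
    · trivial
    · exact (isCube_of_model_cube y).rel 0 1 Nat.zero_lt_one

/-- The morphism `𝒜(S) ⊗ 𝒜(T) → 𝒜(S ⫴ T)`. -/
noncomputable def tensorator (S T : LtimesTS.{u, v}) :
    S.model.tensor T.model ⟶ (S.interleave T).model :=
  (exists_tensorator S T).choose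

theorem state_tensorator (x : (S.model.tensor T.model).pcs.cube 0) :
    state ((tensorator S T).map.app 0 x) = statePair S T x :=
  (exists_tensorator S T).choose_spec.1 x

theorem onLabel_tensorator : (tensorator S T).onLabel = fun a => a :=
  (exists_tensorator S T).choose_spec.2

/-! ### Bijectivity of the comparison morphism -/

/-- The first component of a state of an interleaving. -/
def stateFst (w : (S.interleave T).U.pcs.cube 0) : S.U.pcs.cube 0 :=
  cast (congrArg S.U.pcs.cube (by have := w.1.deg; omega)) w.1.fst

/-- The second component of a state of an interleaving. -/
def stateSnd (w : (S.interleave T).U.pcs.cube 0) : T.U.pcs.cube 0 :=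
  cast (congrArg T.U.pcs.cube (by have := w.1.deg; omega)) w.1.snd

/-- The state of an interleaving given by two states. -/
def stateMk (s : S.U.pcs.cube 0) (t : T.U.pcs.cube 0) : (S.interleave T).U.pcs.cube 0 :=
  ⟨(⟨0, 0, rfl, s, t⟩ : TensorCube S.U.pcs T.U.pcs 0), Nat.zero_le 1⟩

theorem stateMk_fst_snd (w : (S.interleave T).U.pcs.cube 0) :
    stateMk (stateFst w) (stateSnd w) = w := by
  obtain ⟨⟨p, q, h, s, t⟩, hw⟩ := w
  obtain ⟨rfl, rfl⟩ : p = 0 ∧ q = 0 := by omega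
  rfl

theorem exists_left_edge (e : (S.interleave T).U.pcs.cube 1) (s : S.U.Label)
    (he : (S.interleave T).U.label e = Sum.inl s) :
    ∃ (x : S.U.pcs.cube 1) (t : T.U.pcs.cube 0), S.U.label x = s ∧
      ∀ k : Fin 2, (S.interleave T).U.pcs.d rfl k 0 e = stateMk (S.U.pcs.d rfl k 0 x) t := by
  obtain ⟨⟨p, q, h, x, t⟩, hw⟩ := e
  obtain ⟨rfl, rfl⟩ | ⟨rfl, rfl⟩ : (p = 1 ∧ q = 0) ∨ (p = 0 ∧ q = 1) := by omega
  · exact ⟨x, t, Sum.inl_injective he, fun k => rfl⟩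
  · exact absurd he Sum.inr_ne_inl

theorem exists_right_edge (e : (S.interleave T).U.pcs.cube 1) (t : T.U.Label)
    (he : (S.interleave T).U.label e = Sum.inr t) :
    ∃ (s : S.U.pcs.cube 0) (y : T.U.pcs.cube 1), T.U.label y = t ∧
      ∀ k : Fin 2, (S.interleave T).U.pcs.d rfl k 0 e = stateMk s (T.U.pcs.d rfl k 0 y) := by
  obtain ⟨⟨p, q, h, s, y⟩, hw⟩ := e
  obtain ⟨rfl, rfl⟩ | ⟨rfl, rfl⟩ : (p = 1 ∧ q = 0) ∨ (p = 0 ∧ q = 1) := by omega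
  · exact absurd he Sum.inl_ne_inr
  · exact ⟨s, y, Sum.inr_injective he, fun k => rfl⟩

/-- A function of `a` that does not change when the coordinates in `D` are updated only depends on
the other coordinates. -/
theorem eq_of_forall_update_eq {ι α β : Type*} [Finite ι] [DecidableEq ι] (g : (ι → α) → β)
    (D : ι → Prop) (hg : ∀ i, D i → ∀ a k, g (Function.update a i k) = g a) {a b : ι → α}
    (hab : ∀ i, ¬ D i → a i = b i) : g a = g b := by
  classical
  have := Fintype.ofFinite ι
  have key : ∀ s : Finset ι, (∀ i ∈ s, D i) → g (s.piecewise b a) = g a := by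
    intro s
    induction s using Finset.induction_on with
    | empty => intro _; rw [Finset.piecewise_empty]
    | insert j s hj ih =>
      intro h
      rw [Finset.piecewise_insert, hg j (h j (Finset.mem_insert_self j s)),
        ih fun i hi => h i (Finset.mem_insert_of_mem hi)]
  -- Replacing all coordinates in `D` turns `a` into `b`, since the two agree elsewhere.
  rw [← key (Finset.univ.filter D) (by simp)]
  congr 1
  funext i
  by_cases hi : D i
  · simp [Finset.piecewise, hi]
  · simp [Finset.piecewise, hi, hab i hi]

/-- The labels of a cube of an interleaving are first labels of `S`, then labels of `T`. -/
theorem exists_label_split {m : ℕ} (l : Fin m → S.U.Label ⊕ T.U.Label)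
    (hl : ∀ i j : Fin m, i < j → interleaveRel S.rel T.rel (l i) (l j)) :
    ∃ p q : ℕ, ∃ h : p + q = m,
      (∀ i : Fin p, ∃ s, l ⟨i, by omega⟩ = Sum.inl s) ∧
      (∀ j : Fin q, ∃ t, l ⟨p + j, by omega⟩ = Sum.inr t) := by
  classical
  -- The splitting point is the least `p` from which on all labels belong to `T`.
  have hex : ∃ p, p ≤ m ∧ ∀ i : Fin m, p ≤ i → ∃ t, l i = Sum.inr t :=
    ⟨m, le_rfl, fun i hi => absurd i.2 (by omega)⟩
  obtain ⟨hp, hr⟩ := Nat.find_spec hex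
  refine ⟨Nat.find hex, m - Nat.find hex, by omega, fun i => ?_, fun j => hr _ (by simp)⟩
  -- By minimality some `j ≥ i` has a label of `S`. A label of `T` at `i` would then be related to a
  -- label of `S`, which is impossible in an interleaving.
  have hmin := Nat.find_min hex i.2
  push Not at hmin
  obtain ⟨j, hij, hj⟩ := hmin (by omega)
  rcases hlj : l j with s | t
  · rcases hij.eq_or_lt with h | h
    · exact ⟨s, by rw [← hlj]; exact congrArg l (Fin.ext h)⟩
    · rcases hli : l ⟨i, by omega⟩ with s' | t'
      · exact ⟨s', rfl⟩
      · have := hl ⟨i, by omega⟩ j h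
        rw [hli, hlj] at this
        exact this.elim
  · exact absurd hlj (hj t)

theorem append_update {p q : ℕ} (b : Fin p → Fin 2) (c : Fin q → Fin 2) (i : Fin p) (k : Fin 2) :
    Fin.append (Function.update b i k) c =
      Function.update (Fin.append b c) (Fin.castAdd q i) k := by
  funext j
  induction j using Fin.addCases with
  | left j =>
    by_cases h : j = i
    · subst h; simp
    · have : Fin.castAdd q j ≠ Fin.castAdd q i := fun e => h (Fin.castAdd_injective p q e)
      simp [h, this]
  | right j =>
    have : Fin.natAdd p j ≠ Fin.castAdd q i := fun e => by
      have := congrArg Fin.val e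
      simp at this
      omega
    simp [this]

theorem append_update_right {p q : ℕ} (b : Fin p → Fin 2) (c : Fin q → Fin 2) (i : Fin q)
    (k : Fin 2) : Fin.append b (Function.update c i k) =
      Function.update (Fin.append b c) (Fin.natAdd p i) k := by
  funext j
  induction j using Fin.addCases with
  | left j =>
    have : Fin.castAdd q j ≠ Fin.natAdd p i := fun e => by
      have := congrArg Fin.val e
      simp at this
      omega
    simp [this]
  | right j =>
    by_cases h : j = i
    · subst h; simp
    · have : Fin.natAdd p j ≠ Fin.natAdd p i := fun e => h (Fin.natAdd_injective q p e)
      simp [h, this]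

/-- Morphisms commute with taking vertices, which reduces this to the known values in degree 0.
Injectivity and surjectivity both compare vertices through this formula. -/
theorem vertexAt_tensorator {p q n : ℕ} (e : p + q = n) (x : S.model.pcs.cube p)
    (y : T.model.pcs.cube q) (a : Fin n → Fin 2) :
    state (vertexAt ((tensorator S T).map.app n
      (⟨p, q, e, x, y⟩ : TensorCube S.model.pcs T.model.pcs n)) a) =
    stateMk (state (vertexAt x (fun i => a ⟨i, by omega⟩)))
      (state (vertexAt y (fun j => a ⟨p + j, by omega⟩))) :=
  (congrArg state (PrecubicalSet.Hom.app_vertexAt _ _ a).symm).trans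
    ((state_tensorator _).trans (congrArg (statePair S T) (vertexAt_tensor e x y a)))

theorem dirLabel_tensorator {n : ℕ} (c : (S.model.tensor T.model).pcs.cube n) (i : Fin n) :
    (S.interleave T).model.dirLabel ((tensorator S T).map.app n c) i =
      (S.model.tensor T.model).dirLabel c i := by
  rw [HDA.dirLabel_map, onLabel_tensorator]

theorem tensorator_injective (n : ℕ) : Function.Injective ((tensorator S T).map.app n) := by
  intro c c' h
  have hl : (S.model.tensor T.model).dirLabel c = (S.model.tensor T.model).dirLabel c' := by
    funext i
    rw [← dirLabel_tensorator, h, dirLabel_tensorator]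
  obtain ⟨p, q, e, x, y⟩ := c
  obtain ⟨p', q', e', x', y'⟩ := c'
  obtain rfl : p = p' := by
    rcases lt_trichotomy p p' with h' | h' | h'
    -- Direction `p` is the first direction of `y`, but still a direction of `x'`: its label would
    -- come from both `T` and `S`.
    · have h1 := congrFun hl ⟨p, by omega⟩
      rw [HDA.dirLabel_tensor_right e x y p 0 (by omega) (by omega) rfl,
        HDA.dirLabel_tensor_left e' x' y' p h'] at h1
      exact absurd h1 Sum.inr_ne_inl
    · exact h'
    · have h1 := congrFun hl ⟨p', by omega⟩
      rw [HDA.dirLabel_tensor_right e' x' y' p' 0 (by omega) (by omega) rfl,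
        HDA.dirLabel_tensor_left e x y p' h'] at h1
      exact absurd h1 Sum.inl_ne_inr
  obtain rfl : q = q' := by omega
  subst e
  have hv : ∀ a : Fin (p + q) → Fin 2, _ = _ :=
    fun a => congrArg (fun z => state (vertexAt z a)) h
  simp only [vertexAt_tensorator] at hv
  have hx : x = x' := by
    refine model_cube_ext _ _ (fun a => state_injective ?_) (funext fun i => ?_)
    -- The vertices of `x` are seen along any fixed vertex of `y`; the zero coordinates are an
    -- arbitrary choice.
    · have h1 := congrArg stateFst (hv (Fin.append a 0))
      have h2 : (fun i : Fin p => Fin.append a (0 : Fin q → Fin 2) ⟨i, by omega⟩) = a :=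
        funext fun i => Fin.append_left a 0 i
      rw [h2] at h1
      exact h1
    · have h1 := congrFun hl ⟨i, by omega⟩
      rw [HDA.dirLabel_tensor_left _ _ _ i i.2, HDA.dirLabel_tensor_left _ _ _ i i.2] at h1
      exact Sum.inl_injective h1
  have hy : y = y' := by
    refine model_cube_ext _ _ (fun a => state_injective ?_) (funext fun i => ?_)
    · have h1 := congrArg stateSnd (hv (Fin.append 0 a))
      have h2 : (fun i : Fin q => Fin.append (0 : Fin p → Fin 2) a ⟨p + i, by omega⟩) = a :=
        funext fun i => Fin.append_right 0 a i
      rw [h2] at h1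
      exact h1
    · have h1 := congrFun hl ⟨p + i, by omega⟩
      rw [HDA.dirLabel_tensor_right _ _ _ _ i _ i.2 rfl,
        HDA.dirLabel_tensor_right _ _ _ _ i _ i.2 rfl] at h1
      exact Sum.inr_injective h1
  rw [hx, hy]

/-- The labels split into two blocks, and an edge labelled in one system leaves the state of the
other unchanged. So the grid of states `w` is a product of a grid in `S` and a grid in `T`; filling
both gives the preimage. -/
theorem tensorator_surjective (n : ℕ) : Function.Surjective ((tensorator S T).map.app n) := by
  intro z
  have hz := isCube_of_model_cube z
  obtain ⟨p, q, rfl, h1, h2⟩ := exists_label_split ((S.interleave T).model.dirLabel z) hz.rel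
  choose lS hlS using h1
  choose lT hlT using h2
  let w (a : Fin (p + q) → Fin 2) : (S.interleave T).U.pcs.cube 0 := state (vertexAt z a)
  have hleft (i : Fin p) (a) : ∃ (x : S.U.pcs.cube 1) (t : T.U.pcs.cube 0), S.U.label x = lS i ∧
      ∀ k, w (Function.update a (Fin.castAdd q i) k) = stateMk (S.U.pcs.d rfl k 0 x) t := by
    obtain ⟨e, he1, he2⟩ := hz.exists_edge (Fin.castAdd q i) a
    obtain ⟨x, t, hx, ht⟩ := exists_left_edge e (lS i) (he1.trans (hlS i))
    exact ⟨x, t, hx, fun k => (he2 k).symm.trans (ht k)⟩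
  have hright (j : Fin q) (a) : ∃ (s : S.U.pcs.cube 0) (y : T.U.pcs.cube 1), T.U.label y = lT j ∧
      ∀ k, w (Function.update a (Fin.natAdd p j) k) = stateMk s (T.U.pcs.d rfl k 0 y) := by
    obtain ⟨e, he1, he2⟩ := hz.exists_edge (Fin.natAdd p j) a
    obtain ⟨s, y, hy, hs⟩ := exists_right_edge e (lT j) (he1.trans (hlT j))
    exact ⟨s, y, hy, fun k => (he2 k).symm.trans (hs k)⟩
  have hfst {a b : Fin (p + q) → Fin 2} (hab : ∀ i : Fin p, a (Fin.castAdd q i) =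
      b (Fin.castAdd q i)) : stateFst (w a) = stateFst (w b) := by
    refine eq_of_forall_update_eq (fun a => stateFst (w a)) (fun i => p ≤ i) ?_ ?_
    · intro i hi a k
      obtain ⟨j, rfl⟩ : ∃ j : Fin q, Fin.natAdd p j = i :=
        ⟨⟨i - p, by omega⟩, Fin.ext (by simp only [Fin.val_natAdd]; omega)⟩
      obtain ⟨s, y, -, hs⟩ := hright j a
      -- With `k` equal to the present coordinate the update does nothing, so `w a` itself is an end
      -- of the edge and has first component `s`.
      have ha := hs (a (Fin.natAdd p j))
      rw [Function.update_eq_self] at ha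
      simp only [hs k, ha]
      rfl
    · exact fun i hi => hab ⟨i, by omega⟩
  have hsnd {a b : Fin (p + q) → Fin 2} (hab : ∀ i : Fin q, a (Fin.natAdd p i) =
      b (Fin.natAdd p i)) : stateSnd (w a) = stateSnd (w b) := by
    refine eq_of_forall_update_eq (fun a => stateSnd (w a)) (fun i => (i : ℕ) < p) ?_ ?_
    · intro i hi a k
      obtain ⟨x, t, -, ht⟩ := hleft ⟨i, hi⟩ a
      have ha := ht (a i)
      rw [show Fin.castAdd q ⟨i, hi⟩ = i from rfl, Function.update_eq_self] at ha
      rw [show Fin.castAdd q ⟨i, hi⟩ = i from rfl] at ht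
      simp only [ht k, ha]
      rfl
    · intro i hi
      have h := hab ⟨i - p, by omega⟩
      rwa [show Fin.natAdd p ⟨i - p, _⟩ = i from Fin.ext (by simp only [Fin.val_natAdd]; omega)]
        at h
  -- By `hfst`, the coordinates in the block of `T` do not matter here, and 0 serves as a filler.
  have hS : S.IsCube (fun b : Fin p → Fin 2 => stateFst (w (Fin.append b 0))) lS := by
    refine ⟨fun i b => ?_, fun i j hij => ?_⟩
    · obtain ⟨x, t, hx, ht⟩ := hleft i (Fin.append b 0)
      refine ⟨x, hx, fun k => ?_⟩
      simp only [append_update, ht]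
      rfl
    · have h := hz.rel (Fin.castAdd q i) (Fin.castAdd q j) hij
      have hi := hlS i
      have hj := hlS j
      change _ = _ at hi hj
      rw [show Fin.castAdd q i = ⟨i, _⟩ from rfl, show Fin.castAdd q j = ⟨j, _⟩ from rfl, hi, hj]
        at h
      exact h
  have hT : T.IsCube (fun b : Fin q → Fin 2 => stateSnd (w (Fin.append 0 b))) lT := by
    refine ⟨fun i b => ?_, fun i j hij => ?_⟩
    · obtain ⟨s, y, hy, hs⟩ := hright i (Fin.append 0 b)
      refine ⟨y, hy, fun k => ?_⟩
      simp only [append_update_right, hs]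
      rfl
    · have h := hz.rel (Fin.natAdd p i) (Fin.natAdd p j) (Nat.add_lt_add_left hij p)
      rw [show Fin.natAdd p i = ⟨p + i, _⟩ from rfl, show Fin.natAdd p j = ⟨p + j, _⟩ from rfl,
        hlT, hlT] at h
      exact h
  obtain ⟨x, hx1, hx2⟩ := hS.exists_model_cube
  obtain ⟨y, hy1, hy2⟩ := hT.exists_model_cube
  refine ⟨(⟨p, q, rfl, x, y⟩ : TensorCube S.model.pcs T.model.pcs (p + q)), ?_⟩
  refine model_cube_ext _ _ (fun a => state_injective ?_) (funext fun i => ?_)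
  · rw [vertexAt_tensorator, hx1, hy1]
    refine Eq.trans ?_ (stateMk_fst_snd (w a))
    congr 1
    · exact hfst fun i => Fin.append_left _ _ i
    · exact hsnd fun i => Fin.append_right _ _ i
  · refine (dirLabel_tensorator _ i).trans ?_
    induction i using Fin.addCases with
    | left i =>
      refine (HDA.dirLabel_tensor_left rfl x y i i.2).trans ?_
      rw [hx2]
      exact (hlS i).symm
    | right i =>
      refine (HDA.dirLabel_tensor_right rfl x y _ i _ i.2 rfl).trans ?_
      rw [hy2]
      exact (hlT i).symm

end LtimesTS

/-! ### The strong monoidal structure and uniqueness -/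

namespace LtimesTS

variable {S T : LtimesTS.{u, v}}

/-- Besides bijectivity, final states must be reflected; this holds because on both sides they are
the pairs of final states. -/
theorem isIso_tensorator (S T : LtimesTS.{u, v}) : IsIso (tensorator S T) := by
  refine HDA.isIso_of_bijective _ (fun n => ⟨tensorator_injective n, tensorator_surjective n⟩)
    (by rw [onLabel_tensorator]; exact Function.bijective_id) ?_
  rintro ⟨p, q, e, x, y⟩ hx
  obtain ⟨rfl, rfl⟩ : p = 0 ∧ q = 0 := by omega
  have h : statePair S T (⟨0, 0, e, x, y⟩ : TensorCube S.model.pcs T.model.pcs 0) ∈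
      (S.interleave T).U.final :=
    Set.mem_of_eq_of_mem (state_tensorator _).symm hx
  obtain ⟨s, hs, t, ht, h'⟩ := h
  have h1 : statePair S T (⟨0, 0, e, x, y⟩ : TensorCube S.model.pcs T.model.pcs 0) =
    stateMk s t := Subtype.ext h'
  have hxs : state x = s := congrArg stateFst h1
  have hyt : state y = t := congrArg stateSnd h1
  have hx : state x ∈ S.U.final := Set.mem_of_eq_of_mem hxs hs
  have hy : state y ∈ T.U.final := Set.mem_of_eq_of_mem hyt ht
  exact ⟨x, hx, y, hy, rfl⟩

theorem exists_unitComparison : ∃ g : HDA.unit.{u, v} ⟶ unit.model,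
    (∀ x, state (g.map.app 0 x) = x) ∧ g.onLabel = fun a => a :=
  exists_model_hom (T := unit) (fun x => x) (fun a => a) (fun e => absurd e.2 one_ne_zero)
    (fun c => absurd c.2 two_ne_zero) rfl (fun _ hx => hx)

/-- The morphism from the unit to `𝒜` of the unit. -/
noncomputable def unitComparison : HDA.unit.{u, v} ⟶ unit.model :=
  exists_unitComparison.choose

theorem onLabel_unitComparison : unitComparison.{u, v}.onLabel = fun a => a :=
  exists_unitComparison.choose_spec.2

theorem isIso_unitComparison : IsIso unitComparison.{u, v} := by
  refine HDA.isIso_of_bijective _ (fun n => ⟨fun x y _ => Subtype.ext rfl, fun z => ?_⟩)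
    (by rw [onLabel_unitComparison]; exact Function.bijective_id) (fun _ _ => Set.mem_univ _)
  cases n with
  | zero => exact ⟨⟨PUnit.unit, rfl⟩, state_injective (Subtype.ext rfl)⟩
  -- A cube of positive degree has a direction with a label, but the unit has no labels.
  | succ n => exact (unit.model.dirLabel z 0).elim

/-- Vertices of a tensor product of HDAs are pairs of vertices. -/
theorem tensor_vertex_cases {A B : HDA.{u, v}} (c : (A.tensor B).pcs.cube 0) :
    ∃ x y, c = (⟨0, 0, rfl, x, y⟩ : TensorCube A.pcs B.pcs 0) := by
  obtain ⟨p, q, e, x, y⟩ := c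
  obtain ⟨rfl, rfl⟩ : p = 0 ∧ q = 0 := by omega
  exact ⟨x, y, rfl⟩

theorem state_tensorator_mk (x : S.model.pcs.cube 0) (y : T.model.pcs.cube 0) :
    state ((tensorator S T).map.app 0
      (⟨0, 0, rfl, x, y⟩ : TensorCube S.model.pcs T.model.pcs 0)) =
      stateMk (state x) (state y) :=
  state_tensorator _

/-- The target is of the form `𝒜(-)`, so `model_hom_ext` reduces the equation to vertices and
labels, where the tensorator is the identification of pairs of states and the identity. The
coherence equations below hold for the same reason. -/
theorem tensorator_natural {S S' T T' : LtimesTS.{u, v}} (f : S ⟶ S') (g : T ⟶ T') :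
    HDA.tensorMap (hdaModel.map f).hom (hdaModel.map g).hom ≫ tensorator S' T' =
      tensorator S T ≫ (hdaModel.map (interleaveMap f g : S ⊗ T ⟶ S' ⊗ T')).hom := by
  refine model_hom_ext (fun c => ?_) ?_
  · obtain ⟨x, y, rfl⟩ := tensor_vertex_cases c
    exact (state_tensorator_mk _ _).trans
      (congrArg ((interleaveMap f g).onU.map.app 0) (state_tensorator_mk x y)).symm
  · change (fun a => (tensorator S' T').onLabel _) =
      fun a => Sum.map f.onU.onLabel g.onU.onLabel ((tensorator S T).onLabel a)
    rw [onLabel_tensorator, onLabel_tensorator]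
    rfl

theorem tensorator_assoc (S T R : LtimesTS.{u, v}) :
    HDA.tensorMap (tensorator S T) (𝟙 R.model) ≫ tensorator (S.interleave T) R ≫
      (hdaModel.map (assoc S T R).hom).hom =
    (HDA.assoc S.model T.model R.model).hom ≫ HDA.tensorMap (𝟙 S.model) (tensorator T R) ≫
      tensorator S (T.interleave R) := by
  refine model_hom_ext (fun c => ?_) ?_
  · obtain ⟨c, z, rfl⟩ := tensor_vertex_cases c
    obtain ⟨x, y, rfl⟩ := tensor_vertex_cases c
    refine (congrArg ((assoc S T R).hom.onU.map.app 0)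
      ((state_tensorator_mk _ z).trans (congrArg (fun s => stateMk s (state z))
        (state_tensorator_mk x y)))).trans ?_
    exact ((state_tensorator_mk x _).trans (congrArg (fun s => stateMk (state x) s)
        (state_tensorator_mk y z))).symm
  · change (fun a => (assoc S T R).hom.onU.onLabel ((tensorator (S.interleave T) R).onLabel
      (Sum.map (tensorator S T).onLabel (fun a => a) a))) = fun a =>
      (tensorator S (T.interleave R)).onLabel (Sum.map (fun a => a) (tensorator T R).onLabel
        (Equiv.sumAssoc _ _ _ a))
    rw [onLabel_tensorator, onLabel_tensorator, onLabel_tensorator, onLabel_tensorator]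
    funext a
    rcases a with (a | a) | a <;> rfl

theorem tensorator_leftUnit (S : LtimesTS.{u, v}) :
    (HDA.leftUnit S.model).hom = HDA.tensorMap unitComparison (𝟙 S.model) ≫ tensorator unit S ≫
      (hdaModel.map (leftUnit S).hom).hom := by
  refine model_hom_ext (fun c => ?_) ?_
  · obtain ⟨x, y, rfl⟩ := tensor_vertex_cases c
    exact (congrArg ((leftUnit S).hom.onU.map.app 0) (state_tensorator_mk _ y)).symm
  · change _ = fun a => (leftUnit S).hom.onU.onLabel ((tensorator unit S).onLabel
      (Sum.map unitComparison.onLabel (fun a => a) a))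
    rw [onLabel_tensorator]
    funext a
    rcases a with a | a
    · exact a.elim
    · rfl

theorem tensorator_rightUnit (S : LtimesTS.{u, v}) :
    (HDA.rightUnit S.model).hom = HDA.tensorMap (𝟙 S.model) unitComparison ≫ tensorator S unit ≫
      (hdaModel.map (rightUnit S).hom).hom := by
  refine model_hom_ext (fun c => ?_) ?_
  · obtain ⟨x, y, rfl⟩ := tensor_vertex_cases c
    exact (congrArg ((rightUnit S).hom.onU.map.app 0) (state_tensorator_mk x _)).symm
  · change _ = fun a => (rightUnit S).hom.onU.onLabel ((tensorator S unit).onLabel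
      (Sum.map (fun a => a) unitComparison.onLabel a))
    rw [onLabel_tensorator]
    funext a
    rcases a with a | a
    · rfl
    · exact a.elim

/-- The isomorphism of extensional HDAs underlying the tensorator. -/
noncomputable def tensoratorIso (S T : LtimesTS.{u, v}) :
    hdaModel.obj S ⊗ hdaModel.obj T ≅ hdaModel.obj (S ⊗ T) :=
  HDA.IsExtensional.isoMk (@asIso _ _ _ _ (tensorator S T) (isIso_tensorator S T))

/-- The isomorphism of extensional HDAs underlying the unit comparison. -/
noncomputable def unitComparisonIso :
    𝟙_ HDAext.{u, v} ≅ hdaModel.obj (𝟙_ LtimesTS.{u, v}) :=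
  HDA.IsExtensional.isoMk (@asIso _ _ _ _ unitComparison isIso_unitComparison)

/-- The strong monoidal structure of the HDA model functor. -/
noncomputable def hdaModelCoreMonoidal : (hdaModel.{u, v}).CoreMonoidal where
  εIso := unitComparisonIso
  μIso := tensoratorIso
  μIso_hom_natural_left f T := ObjectProperty.hom_ext _ (by
    -- Whiskering is tensoring with the identity of `𝒜(T)`, which is the image of `𝟙 T`.
    refine Eq.trans ?_ (tensorator_natural f (𝟙 T))
    rw [hdaModel.map_id]
    rfl)
  μIso_hom_natural_right S f := ObjectProperty.hom_ext _ (by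
    refine Eq.trans ?_ (tensorator_natural (𝟙 S) f)
    rw [hdaModel.map_id]
    rfl)
  associativity S T R := ObjectProperty.hom_ext _ (tensorator_assoc S T R)
  left_unitality S := ObjectProperty.hom_ext _ (tensorator_leftUnit S)
  right_unitality S := ObjectProperty.hom_ext _ (tensorator_rightUnit S)

theorem restrictsToId_tensorator (S T : LtimesTS.{u, v}) :
    RestrictsToId (tensoratorIso S T).hom := by
  have h0 (x) : ((HDA.skeletonMap 1 (tensorator S T) ≫
      (S ⊗ T).skeletonModel.hom).map.app 0 x : (S.interleave T).U.pcs.cube 0) =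
      (skeletonModelTensor S T).hom.map.app 0 x := state_tensorator x.1
  have hl (a) : ((HDA.skeletonMap 1 (tensorator S T) ≫
      (S ⊗ T).skeletonModel.hom).onLabel a : (S.interleave T).U.Label) =
      (skeletonModelTensor S T).hom.onLabel a := by
    refine (congrFun onLabel_tensorator a).trans ?_
    rcases a with a | a <;> rfl
  refine HDA.Hom.ext (PrecubicalSet.Hom.ext ?_) (funext hl)
  funext m x
  match m, x with
  | 0, x => exact h0 x
  | 1, x =>
    -- The tensorator was characterized only on vertices and labels; extensionality of `U(S ⫴ T)`
    -- yields the agreement on edges.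
    refine (S ⊗ T).isExtensionalTruncated.1 _ _ ?_ ?_ ?_
    · exact (HDA.Hom.label_map _ x).trans ((hl _).trans (HDA.Hom.label_map _ x).symm)
    · exact (PrecubicalSet.Hom.map_d _ rfl 0 0 x).symm.trans
        ((h0 _).trans (PrecubicalSet.Hom.map_d _ rfl 0 0 x))
    · exact (PrecubicalSet.Hom.map_d _ rfl 1 0 x).symm.trans
        ((h0 _).trans (PrecubicalSet.Hom.map_d _ rfl 1 0 x))
  | m + 2, x => exact absurd x.2 (by omega)

/-- The restriction to 1-skeleta already records the effect on vertices and labels, and these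
determine a morphism to `𝒜(S ⫴ T)`. -/
theorem RestrictsToId.ext {g g' : hdaModel.obj S ⊗ hdaModel.obj T ⟶ hdaModel.obj (S ⊗ T)}
    (hg : RestrictsToId g) (hg' : RestrictsToId g') : g = g' := by
  have h := hg.trans hg'.symm
  refine ObjectProperty.hom_ext _ (model_hom_ext (fun x => ?_) ?_)
  · exact congrArg (fun f => f.map.app 0 ⟨x, Nat.zero_le 1⟩) h
  · exact congrArg (fun f => f.onLabel) h

end LtimesTS

theorem mainTheorem2 :
    ∃ M : (LtimesTS.hdaModel.{u, v}).Monoidal,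
      ∀ S T : LtimesTS.{u, v},
        LtimesTS.RestrictsToId (M.μ S T) ∧
        ∀ g : LtimesTS.hdaModel.obj S ⊗ LtimesTS.hdaModel.obj T ⟶ LtimesTS.hdaModel.obj (S ⊗ T),
          LtimesTS.RestrictsToId g → g = M.μ S T :=
  ⟨LtimesTS.hdaModelCoreMonoidal.toMonoidal, fun S T =>
    ⟨LtimesTS.restrictsToId_tensorator S T,
      fun _ hg => hg.ext (LtimesTS.restrictsToId_tensorator S T)⟩⟩
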